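/- For an arithmetical function $f$ and real $x>1$ put $$L(x;f)=\sum_{k\le x}\frac1k\sum_{j=1}^{k}f(\gcd(k,j))\log j .$$ For real $b$ let $\mathrm{id}_b(n)=n^b$, $\phi_b=\mu*\mathrm{id}_b$ and $\sigma_b=\mathbf 1*\mathrm{id}_b$, where $*$ is Dirichlet convolution and $\mu$ is the Möbius function. Let $-1<a<0$, let $\zeta$ be the Riemann zeta function, and define $\Delta_a(x)$ by $$\sum_{n\le x}\sigma_a(n)=\zeta(1-a)x+\frac{\zeta(1+a)}{1+a}x^{1+a}-\frac{\zeta(-a)}2+\Delta_a(x).$$ Let $r(l)=\log l!-\bigl(l\log l-l+\tfrac12\log l+\log\sqrt{2\pi}\bigr)$ be the remainder in Stirling's formula. Theorem. For every $a$ with $-1<a<0$ there is a constant $\Theta=\Theta(a)$ with $0<\Theta<\frac1{12}$, namely the one given by the convergent series $\Theta\,\zeta(3+a)=\sum_{l=1}^{\infty} r(l)\,l^{-2-a}$, such that, as $x\to\infty$, $$\begin{aligned} L(x;\mathrm{id}_{1+a})={}&\frac{\zeta(1-a)}{\zeta(2)}x\log x-\frac{2\zeta(1-a)}{\zeta(2)}x+\frac{\zeta(1+a)}{(1+a)\zeta(2+a)}x^{1+a}\log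 x\\ &-\frac1{(1+a)\zeta(2+a)}\Bigl(\frac{(2+a)\zeta(1+a)}{1+a}+\frac{\zeta'(2+a)}2-\Theta\zeta(3+a)\Bigr)x^{1+a}\\ &+\frac{\log\sqrt{2\pi}}{1+a}x^{1+a}+\Bigl(\sum_{n\le x}\frac{\mu(n)}n\Delta_a\Bigl(\frac xn\Bigr)\Bigr)\log\frac xe+O_a(\log x) \end{aligned}$$ and $$\begin{aligned} L(x;\phi_{1+a})={}&\frac{\zeta(1-a)}{\zeta^2(2)}x\log x-\frac{2\zeta(1-a)}{\zeta^2(2)}x+\frac{\zeta(1+a)}{(1+a)\zeta^2(2+a)}x^{1+a}\log x\\ &-\frac1{(1+a)\zeta^2(2+a)}\Bigl(\frac{(2+a)\zeta(1+a)}{1+a}+\frac{\zeta'(2+a)}2-\Theta\zeta(3+a)\Bigr)x^{1+a}\\ &+\frac{\log\sqrt{2\pi}}{(1+a)\zeta(2+a)}x^{1+a}+\Bigl(\sum_{n\le x}\frac{(\mu*\mu)(n)}n\Delta_a\Bigl(\frac xn\Bigr)\Bigr)\log\frac xe+O_a\bigl((\log x)^3\bigr). \end{aligned}$$ -/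

import Mathlib

open Filter Asymptotics

noncomputable section

namespace LogGcdSum

/-- The Riemann zeta function at a real argument; its value there is real. -/
def zetaR (s : ℝ) : ℝ := (riemannZeta (s : ℂ)).re

/-- The derivative of the Riemann zeta function at a real argument; its value there is real. -/
def zetaR' (s : ℝ) : ℝ := (deriv riemannZeta (s : ℂ)).re

/-- The arithmetical function `n ↦ n ^ a` on the positive integers, for real `a`. -/
def idPow (a : ℝ) : ArithmeticFunction ℝ :=
  ⟨fun n => if n = 0 then 0 else (n : ℝ) ^ a, if_pos rfl⟩

/-- The real-valued Möbius function. -/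
def moebiusR : ArithmeticFunction ℝ :=
  ((ArithmeticFunction.moebius : ArithmeticFunction ℤ) : ArithmeticFunction ℝ)

/-- The Jordan totient function `φ_a = μ * id_a`. -/
def jordan (a : ℝ) : ArithmeticFunction ℝ := moebiusR * idPow a

/-- The generalized divisor function `σ_a = 1 * id_a`. -/
def sigmaR (a : ℝ) : ArithmeticFunction ℝ :=
  ((ArithmeticFunction.zeta : ArithmeticFunction ℕ) : ArithmeticFunction ℝ) * idPow a

/-- `L(x; f) = ∑_{k ≤ x} (1/k) ∑_{j=1}^{k} f(gcd(k, j)) log j`. -/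
def logGcdSum (x : ℝ) (f : ArithmeticFunction ℝ) : ℝ :=
  ∑ k ∈ Finset.Icc 1 ⌊x⌋₊,
    (1 / (k : ℝ)) * ∑ j ∈ Finset.Icc 1 k, f (Nat.gcd k j) * Real.log j

/-- The error term `Δ_a(x)` in the summatory function of `σ_a`, defined by
`∑_{n ≤ x} σ_a(n) = ζ(1-a) x + ζ(1+a)/(1+a) x^{1+a} - ζ(-a)/2 + Δ_a(x)`. -/
def Delta (a x : ℝ) : ℝ :=
  (∑ n ∈ Finset.Icc 1 ⌊x⌋₊, sigmaR a n) -
    (zetaR (1 - a) * x + zetaR (1 + a) / (1 + a) * x ^ (1 + a) - zetaR (-a) / 2)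

/-- `∑_{n ≤ x} (g(n)/n) Δ_a(x/n)`. -/
def deltaSum (g : ArithmeticFunction ℝ) (a x : ℝ) : ℝ :=
  ∑ n ∈ Finset.Icc 1 ⌊x⌋₊, g n / (n : ℝ) * Delta a (x / n)

/-- The remainder in Stirling's formula
`log l! = l log l - l + (1/2) log l + log √(2π) + stirlingRem l`. -/
def stirlingRem (l : ℕ) : ℝ :=
  Real.log (Nat.factorial l) -
    (l * Real.log l - l + 1 / 2 * Real.log l + Real.log (Real.sqrt (2 * Real.pi)))

end LogGcdSum

end

noncomputable section

namespace LogGcdSum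

open MeasureTheory Set Topology

/-! ### The sawtooth function -/

/-! Write `f = g * 1`. Grouping the `j ≤ k` by the divisors `d` of `gcd(k, j)` leaves `log (k/d)!`,
and Stirling's formula `log l! / l = log l - 1 + stirlingTail l` shows that the `k`-th term of `L(x;
f)` is `(g/id * 1)(k) (log k - 1) + (g/id * stirlingTail)(k)`. With `log k = log x - log (x/k)` this
becomes the three-term identity `logGcdSum_eq`.

For `f = id_{1+a}` one has `g/id = μ/id * id_a`, so `g/id * 1 = μ/id * σ_a`. Each of the three sums
is then a Möbius twist `W ↦ ∑_{n ≤ x} (μ(n)/n) W(x/n)` of something known.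

The unweighted sum of `σ_a` is expanded by the definition of `Δ_a`; its constant term stays bounded
under the twist because `∑_{n ≤ x} μ(n)/n` is bounded (`logBdd_dsum_sigmaR_one`).

The sum of `σ_a(k) log (y/k)` is `∫_1^y u⁻¹ ∑_{k ≤ u} σ_a(k) du`. The crucial point is that `∫_1^y
Δ_a(u) du/u` is bounded: the hyperbola method gives `Δ_a(u) = -sawtoothSum a u + O(u^(a/2))`
(`abs_Delta_add_sawtoothSum_le`), and the sawtooth terms oscillate, so that the `d`-th one
integrates to `O(d^(a-1))` (`abs_integral_sawtoothSum_le`). This gives `abs_dsum_sigmaR_log_sub_le`.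

In the Stirling part, `μ/id` turns `log/id` into `Λ/id` and `1/id` into the unit. The first produces
`ζ'/ζ(2+a)`, the second `log √(2π)`, and the remainder `r(l)/l` produces `Θ ζ(3+a)`
(`logBdd_dsum_stirlingTail`). The bounds on `Θ` come from `0 < r(l) ≤ 1/(12 l)`, with strict
inequality at `l = 1`.

For `f = φ_{1+a}` there is one further Möbius twist, which multiplies main terms by `1/ζ(2)` or
`1/ζ(2+a)` and costs one logarithm in the error (`LogBdd.dsum_moebius_expansion`). -/

/-- The centred fractional part `{t} - 1/2`. -/
def sawtooth (t : ℝ) : ℝ := Int.fract t - 1 / 2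

/-- A continuous periodic primitive of the sawtooth function. -/
def sawtoothPrim (t : ℝ) : ℝ := (Int.fract t ^ 2 - Int.fract t) / 2

lemma abs_sawtooth_le (t : ℝ) : |sawtooth t| ≤ 1 / 2 := by
  have h1 := Int.fract_nonneg t
  have h2 := Int.fract_lt_one t
  rw [sawtooth, abs_le]
  constructor <;> linarith

lemma abs_sawtoothPrim_le (t : ℝ) : |sawtoothPrim t| ≤ 1 / 8 := by
  have h1 := Int.fract_nonneg t
  have h2 := Int.fract_lt_one t
  rw [sawtoothPrim, abs_le]
  constructor <;> nlinarith [sq_nonneg (Int.fract t - 1 / 2)]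

lemma measurable_sawtooth : Measurable sawtooth :=
  measurable_fract.sub_const _

lemma continuous_sawtoothPrim : Continuous sawtoothPrim := by
  have : ContinuousOn (fun t : ℝ => (t ^ 2 - t) / 2) (Icc 0 1) := by fun_prop
  exact ContinuousOn.comp_fract'' this (by norm_num)

/-- The sawtooth is right-continuous, so the right derivative exists at integers too; that is all
the fundamental theorem of calculus used below needs. -/
lemma hasDerivWithinAt_sawtoothPrim (t : ℝ) :
    HasDerivWithinAt sawtoothPrim (sawtooth t) (Ioi t) t := by
  have h : HasDerivAt (fun u : ℝ => ((u - ⌊t⌋) ^ 2 - (u - ⌊t⌋)) / 2) (sawtooth t) t := by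
    have h1 : HasDerivAt (fun u : ℝ => u - ⌊t⌋) 1 t := (hasDerivAt_id t).sub_const _
    refine (((h1.pow 2).sub h1).div_const 2).congr_deriv ?_
    rw [sawtooth, ← Int.self_sub_floor]
    norm_num
    ring
  refine h.hasDerivWithinAt.congr_of_eventuallyEq ?_ ?_
  · have : Ioo t (⌊t⌋ + 1) ∈ 𝓝[>] t := Ioo_mem_nhdsGT (Int.lt_floor_add_one t)
    filter_upwards [this] with u hu
    have : ⌊u⌋ = ⌊t⌋ := by
      rw [Int.floor_eq_iff]
      exact ⟨(Int.floor_le t).trans hu.1.le, hu.2⟩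
    simp only [sawtoothPrim, ← Int.self_sub_floor, this]
  · simp only [sawtoothPrim, ← Int.self_sub_floor]

lemma intervalIntegrable_sawtooth (a b : ℝ) : IntervalIntegrable sawtooth volume a b := by
  refine (intervalIntegrable_const (c := (1 / 2 : ℝ))).mono_fun
    measurable_sawtooth.aestronglyMeasurable ?_
  filter_upwards with t
  simpa using abs_sawtooth_le t

lemma intervalIntegrable_sawtooth_mul_rpow {α β : ℝ} (hα : 0 < α) (hβ : α ≤ β) (p : ℝ) :
    IntervalIntegrable (fun u => sawtooth u * u ^ p) volume α β := by
  refine (intervalIntegrable_sawtooth α β).mul_continuousOn ?_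
  rw [uIcc_of_le hβ]
  exact fun u hu =>
    (Real.continuousAt_rpow_const _ _ (Or.inl (hα.trans_le hu.1).ne')).continuousWithinAt

/-- Integration by parts against the bounded primitive. With `|sawtoothPrim| ≤ 1/8`, the boundary
terms give `(α^(-p) + β^(-p))/8` and the remaining integral at most `(α^(-p) - β^(-p))/8`. -/
lemma abs_integral_sawtooth_mul_rpow_le {α β p : ℝ} (hα : 0 < α) (hβ : α ≤ β) (hp : 0 < p) :
    |∫ u in α..β, sawtooth u * u ^ (-p)| ≤ α ^ (-p) / 4 := by
  have hpos : ∀ u ∈ Icc α β, 0 < u := fun u hu => hα.trans_le hu.1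
  have hrc : ∀ q : ℝ, ContinuousOn (fun u : ℝ => u ^ q) (uIcc α β) := fun q u hu => by
    rw [uIcc_of_le hβ] at hu
    exact (Real.continuousAt_rpow_const _ _ (Or.inl (hpos u hu).ne')).continuousWithinAt
  have hi1 := intervalIntegrable_sawtooth_mul_rpow hα hβ (-p)
  have hc2 : ContinuousOn (fun u => sawtoothPrim u * (-p * u ^ (-p - 1))) (uIcc α β) :=
    continuous_sawtoothPrim.continuousOn.mul (continuousOn_const.mul (hrc _))
  have hi2 := hc2.intervalIntegrable (μ := volume)
  have key := intervalIntegral.integral_eq_sub_of_hasDeriv_right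
    (a := α) (b := β) (f := fun u => sawtoothPrim u * u ^ (-p))
    (f' := fun u => sawtooth u * u ^ (-p) + sawtoothPrim u * (-p * u ^ (-p - 1)))
    (continuous_sawtoothPrim.continuousOn.mul (hrc _)) (fun u hu => by
      rw [min_eq_left hβ, max_eq_right hβ] at hu
      exact (hasDerivWithinAt_sawtoothPrim u).mul
        (Real.hasDerivAt_rpow_const (Or.inl (hα.trans hu.1).ne')).hasDerivWithinAt)
    (hi1.add hi2)
  rw [intervalIntegral.integral_add hi1 hi2] at key
  have hb : |∫ u in α..β, sawtoothPrim u * (-p * u ^ (-p - 1))| ≤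
      ∫ u in α..β, 1 / 8 * (p * u ^ (-p - 1)) := by
    rw [← Real.norm_eq_abs]
    refine intervalIntegral.norm_integral_le_of_norm_le hβ (ae_of_all _ fun u hu => ?_) ?_
    · have hu0 := hα.trans hu.1
      rw [Real.norm_eq_abs, abs_mul, abs_mul, abs_neg, abs_of_pos hp,
        abs_of_pos (Real.rpow_pos_of_pos hu0 _)]
      gcongr
      exact abs_sawtoothPrim_le u
    · exact (continuousOn_const.mul (continuousOn_const.mul (hrc _))).intervalIntegrable
  rw [intervalIntegral.integral_const_mul, intervalIntegral.integral_const_mul,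
    integral_rpow (Or.inr ⟨by linarith, by rw [uIcc_of_le hβ]; exact fun h => (hpos 0 h).false⟩)]
    at hb
  have e : p * ((β ^ (-p - 1 + 1) - α ^ (-p - 1 + 1)) / (-p - 1 + 1)) = α ^ (-p) - β ^ (-p) := by
    rw [sub_add_cancel]; field_simp; ring
  rw [e] at hb
  have h1 : |sawtoothPrim β * β ^ (-p)| ≤ 1 / 8 * β ^ (-p) := by
    rw [abs_mul, abs_of_pos (Real.rpow_pos_of_pos (hα.trans_le hβ) _)]
    exact mul_le_mul_of_nonneg_right (abs_sawtoothPrim_le β) (Real.rpow_nonneg (hα.trans_le hβ).le _)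
  have h2 : |sawtoothPrim α * α ^ (-p)| ≤ 1 / 8 * α ^ (-p) := by
    rw [abs_mul, abs_of_pos (Real.rpow_pos_of_pos hα _)]
    gcongr
    exact abs_sawtoothPrim_le α
  have hαp := Real.rpow_pos_of_pos hα (-p)
  rw [abs_le] at hb h1 h2 ⊢
  constructor <;> linarith

/-! ### The zeta function to the right of `0` -/

/-- The fractional part cut off to `(1, ∞)`. -/
def fractTail (t : ℝ) : ℂ := (Ioi (1 : ℝ)).indicator (fun t => ((Int.fract t : ℝ) : ℂ)) t

lemma measurable_fractTail : Measurable fractTail :=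
  (Complex.measurable_ofReal.comp measurable_fract).indicator measurableSet_Ioi

lemma norm_fractTail_le (t : ℝ) : ‖fractTail t‖ ≤ 1 := by
  rw [fractTail, indicator]
  split_ifs
  · rw [Complex.norm_real, Real.norm_eq_abs, abs_of_nonneg (Int.fract_nonneg t)]
    exact (Int.fract_lt_one t).le
  · simp

lemma locallyIntegrable_fractTail : LocallyIntegrable fractTail :=
  (locallyIntegrable_const (1 : ℝ)).mono measurable_fractTail.aestronglyMeasurable
    (by filter_upwards with t; simpa using norm_fractTail_le t)

lemma differentiableAt_mellin_fractTail {s : ℂ} (hs : s.re < 0) :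
    DifferentiableAt ℂ (mellin fractTail) s := by
  -- Boundedness at infinity forces `s.re < 0`; near `0` the function vanishes, so any exponent
  -- below `s.re` would serve as `b`.
  refine mellin_differentiableAt_of_isBigO_rpow (a := 0) (b := s.re - 1)
    (locallyIntegrable_fractTail.locallyIntegrableOn _) ?_ hs ?_ (by linarith)
  · refine IsBigO.of_bound 1 ?_
    filter_upwards with t
    simpa using norm_fractTail_le t
  · refine IsBigO.of_bound 1 ?_
    have : Ioo (0 : ℝ) 1 ∈ 𝓝[>] (0 : ℝ) := Ioo_mem_nhdsGT one_pos
    filter_upwards [this] with t ht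
    have : fractTail t = 0 := indicator_of_notMem (by simpa using ht.2.le) _
    rw [this, norm_zero]
    positivity

lemma mellin_fractTail_neg (s : ℂ) :
    mellin fractTail (-s) = ∫ t in Ioi (1 : ℝ), ((Int.fract t : ℝ) : ℂ) * (t : ℂ) ^ (-(s + 1)) := by
  have h1 : ∀ t : ℝ, (t : ℂ) ^ (-s - 1) • fractTail t =
      (Ioi (1 : ℝ)).indicator (fun t : ℝ => ((Int.fract t : ℝ) : ℂ) * (t : ℂ) ^ (-(s + 1))) t := by
    intro t
    by_cases ht : t ∈ Ioi (1 : ℝ)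
    · simp only [fractTail, indicator_of_mem ht, smul_eq_mul]
      rw [mul_comm]; congr 2; ring
    · simp [fractTail, indicator_of_notMem ht]
  rw [mellin]
  simp_rw [h1]
  rw [setIntegral_indicator measurableSet_Ioi]
  congr 2
  ext t; simp only [mem_inter_iff, mem_Ioi]
  exact ⟨fun h => h.2, fun h => ⟨one_pos.trans h, h⟩⟩

lemma sum_Icc_floor_one {t : ℝ} (ht : 0 ≤ t) :
    (∑ _k ∈ Finset.Icc 1 ⌊t⌋₊, (1 : ℝ)) = t - Int.fract t := by
  simp only [Finset.sum_const, Nat.card_Icc, add_tsub_cancel_right, nsmul_eq_mul, mul_one]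
  rw [natCast_floor_eq_intCast_floor ht, Int.self_sub_fract]

lemma riemannZeta₀_eq_of_one_lt_re {s : ℂ} (hs : 1 < s.re) :
    riemannZeta₀ s = 1 - s * mellin fractTail (-s) := by
  have hs1 : s ≠ 1 := by rintro rfl; simp at hs
  have hs0 : s ≠ 0 := by rintro rfl; simp at hs; linarith
  have hO : (fun n : ℕ => ∑ k ∈ Finset.Icc 1 n, ‖(1 : ℕ → ℂ) k‖) =O[atTop]
      fun n => (n : ℝ) ^ (1 : ℝ) := by
    refine IsBigO.of_bound 1 ?_
    filter_upwards with n
    simp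
  have h := LSeries_eq_mul_integral' (1 : ℕ → ℂ) zero_le_one hs hO
  rw [LSeries_one_eq_riemannZeta hs] at h
  have hi0 : IntegrableOn (fun t : ℝ => (t : ℂ) ^ (-s)) (Ioi 1) :=
    integrableOn_Ioi_cpow_of_lt (by simpa using hs) one_pos
  have hi1 : IntegrableOn (fun t : ℝ => ((Int.fract t : ℝ) : ℂ) * (t : ℂ) ^ (-(s + 1))) (Ioi 1) := by
    refine Integrable.bdd_mul (c := 1) (integrableOn_Ioi_cpow_of_lt (by simp; linarith) one_pos)
      (Complex.measurable_ofReal.comp measurable_fract).aestronglyMeasurable ?_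
    filter_upwards with t
    rw [Complex.norm_real, Real.norm_eq_abs, abs_of_nonneg (Int.fract_nonneg t)]
    exact (Int.fract_lt_one t).le
  have hint : (∫ t in Ioi (1 : ℝ), (∑ k ∈ Finset.Icc 1 ⌊t⌋₊, (1 : ℕ → ℂ) k) *
      (t : ℂ) ^ (-(s + 1))) = 1 / (s - 1) - mellin fractTail (-s) := by
    rw [mellin_fractTail_neg]
    have e1 : (1 : ℂ) / (s - 1) = ∫ t in Ioi (1 : ℝ), (t : ℂ) ^ (-s) := by
      rw [integral_Ioi_cpow_of_lt (by simpa using hs) one_pos]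
      have : -s + 1 ≠ 0 := fun h => hs1 (by linear_combination -h)
      have : s - 1 ≠ 0 := sub_ne_zero.mpr hs1
      simp only [Complex.ofReal_one, Complex.one_cpow]
      rw [div_eq_div_iff ‹_› ‹_›]; ring
    rw [e1, ← integral_sub hi0 hi1]
    refine setIntegral_congr_fun measurableSet_Ioi fun t ht => ?_
    have ht0 : (0 : ℝ) < t := one_pos.trans ht
    have e2 : (∑ k ∈ Finset.Icc 1 ⌊t⌋₊, (1 : ℕ → ℂ) k) = (t : ℂ) - (Int.fract t : ℝ) := by
      have := congrArg (Complex.ofReal) (sum_Icc_floor_one ht0.le)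
      rw [Complex.ofReal_sum, Complex.ofReal_sub] at this
      simpa only [Pi.one_apply, Complex.ofReal_one] using this
    simp only [e2, sub_mul]
    congr 1
    rw [show -s = -(s + 1) + 1 by ring, Complex.cpow_add _ _ (by exact_mod_cast ht0.ne'),
      Complex.cpow_one, mul_comm]
  rw [hint] at h
  have hs2 : s - 1 ≠ 0 := sub_ne_zero.mpr hs1
  rw [riemannZeta₀, if_neg hs1, h]
  field_simp
  ring

/-- Analytic continuation: both sides are holomorphic on the half-plane `Re s > 0` and agree near
`2`. The arguments `1 + a` and `-a` lie in `(0, 1)`, outside the range of the Dirichlet series. -/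
lemma riemannZeta₀_eq_of_re_pos {s : ℂ} (hs : 0 < s.re) :
    riemannZeta₀ s = 1 - s * mellin fractTail (-s) := by
  have hopen : IsOpen {z : ℂ | 0 < z.re} := isOpen_lt continuous_const Complex.continuous_re
  have hd : DifferentiableOn ℂ (fun z : ℂ => 1 - z * mellin fractTail (-z)) {z : ℂ | 0 < z.re} := by
    intro z hz
    have hz' : (-z).re < 0 := by simpa using hz
    have h1 : DifferentiableAt ℂ (fun z => mellin fractTail (-z)) z :=
      (differentiableAt_mellin_fractTail hz').comp z differentiableAt_id.neg
    exact ((differentiableAt_const _).sub (differentiableAt_id.mul h1)).differentiableWithinAt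
  have ha := differentiable_riemannZeta₀.differentiableOn.analyticOnNhd hopen
  refine ha.eqOn_of_preconnected_of_eventuallyEq
    (hd.analyticOnNhd hopen) (convex_halfSpace_re_gt 0).isPreconnected (z₀ := 2) (by simp) ?_ hs
  have : {z : ℂ | 1 < z.re} ∈ 𝓝 (2 : ℂ) :=
    (isOpen_lt continuous_const Complex.continuous_re).mem_nhds (by simp)
  filter_upwards [this] with z hz using riemannZeta₀_eq_of_one_lt_re hz

lemma zetaR_eq {s : ℝ} (hs : 0 < s) (hs1 : s ≠ 1) :
    zetaR s = s / (s - 1) - s * ∫ t in Ioi (1 : ℝ), Int.fract t * t ^ (-s - 1) := by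
  have hs1' : (s : ℂ) ≠ 1 := by exact_mod_cast hs1
  have hm : mellin fractTail (-s) =
      ((∫ t in Ioi (1 : ℝ), Int.fract t * t ^ (-s - 1) : ℝ) : ℂ) := by
    rw [mellin_fractTail_neg, ← integral_complex_ofReal]
    refine setIntegral_congr_fun measurableSet_Ioi fun t ht => ?_
    have ht0 : (0 : ℝ) < t := one_pos.trans ht
    simp only [Complex.ofReal_mul, Complex.ofReal_cpow ht0.le]
    push_cast
    congr 2; ring
  have h2 : s - 1 ≠ 0 := sub_ne_zero.mpr hs1
  rw [zetaR, riemannZeta_eq_inv_sub_add hs1', riemannZeta₀_eq_of_re_pos (by simpa using hs), hm]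
  norm_cast
  field_simp
  ring

/-! ### Partial summation and the Euler-Maclaurin formula for `∑ n ^ (-s)` -/

lemma sum_Icc_one_mul_eq_sub_integral (c : ℕ → ℝ) {f f' : ℝ → ℝ} {b : ℝ} (hb : 1 ≤ b)
    (hf : ∀ t ∈ Icc 1 b, HasDerivAt f (f' t) t) (hf' : ContinuousOn f' (Icc 1 b)) :
    ∑ k ∈ Finset.Icc 1 ⌊b⌋₊, f k * c k = f b * ∑ k ∈ Finset.Icc 1 ⌊b⌋₊, c k -
      ∫ t in (1 : ℝ)..b, f' t * ∑ k ∈ Finset.Icc 1 ⌊t⌋₊, c k := by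
  -- The Abel summation formula applied here starts at `0` and wants a vanishing zeroth coefficient.
  set d : ℕ → ℝ := fun k => if k = 0 then 0 else c k with hd
  have hsum : ∀ (g : ℕ → ℝ) (n : ℕ),
      ∑ k ∈ Finset.Icc 0 n, g k * d k = ∑ k ∈ Finset.Icc 1 n, g k * c k := by
    intro g n
    rw [← Finset.insert_Icc_add_one_left_eq_Icc (Nat.zero_le n), Finset.sum_insert (by simp)]
    simp only [hd, if_true, mul_zero, zero_add]
    exact Finset.sum_congr rfl fun k hk => by
      rw [if_neg (by have := (Finset.mem_Icc.mp hk).1; lia)]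
  have hsum1 : ∀ n : ℕ, ∑ k ∈ Finset.Icc 0 n, d k = ∑ k ∈ Finset.Icc 1 n, c k := fun n => by
    simpa using hsum (fun _ => 1) n
  have hder : EqOn (deriv f) f' (Icc 1 b) := fun t ht => (hf t ht).deriv
  have h := sum_mul_eq_sub_integral_mul₀ (𝕜 := ℝ) (f := f) d (by simp [hd]) b
    (fun t ht => (hf t ht).differentiableAt)
    ((hf'.integrableOn_Icc).congr_fun hder.symm measurableSet_Icc)
  rw [hsum (fun k => f k), hsum1] at h
  rw [h, intervalIntegral.integral_of_le hb]
  congr 1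
  refine setIntegral_congr_fun measurableSet_Ioc fun t ht => ?_
  simp only [hsum1, hder (Ioc_subset_Icc_self ht)]

/-- The partial sums `∑_{n ≤ t} n ^ (-s)`. -/
def powSum (s t : ℝ) : ℝ := ∑ n ∈ Finset.Icc 1 ⌊t⌋₊, (n : ℝ) ^ (-s)

lemma continuousOn_rpow_Icc (q : ℝ) {α β : ℝ} (hα : 0 < α) :
    ContinuousOn (fun u : ℝ => u ^ q) (Icc α β) := fun _ hu =>
  (Real.continuousAt_rpow_const _ _ (Or.inl (hα.trans_le hu.1).ne')).continuousWithinAt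

lemma intervalIntegrable_rpow_of_pos (q : ℝ) {α β : ℝ} (hα : 0 < α) (hβ : α ≤ β) :
    IntervalIntegrable (fun u : ℝ => u ^ q) volume α β := by
  refine ContinuousOn.intervalIntegrable ?_
  rw [uIcc_of_le hβ]
  exact continuousOn_rpow_Icc q hα

lemma integral_rpow_of_pos {q α β : ℝ} (hq : q ≠ -1) (hα : 0 < α) (hβ : α ≤ β) :
    ∫ u in α..β, u ^ q = (β ^ (q + 1) - α ^ (q + 1)) / (q + 1) :=
  integral_rpow (Or.inr ⟨hq, by rw [uIcc_of_le hβ]; exact fun h => (hα.trans_le h.1).false⟩)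

lemma integrableOn_sawtooth_mul_rpow {s : ℝ} (hs : 0 < s) :
    IntegrableOn (fun u => sawtooth u * u ^ (-s - 1)) (Ioi 1) := by
  refine Integrable.bdd_mul (c := 1 / 2) (integrableOn_Ioi_rpow_of_lt (by linarith) one_pos)
    measurable_sawtooth.aestronglyMeasurable ?_
  filter_upwards with t using abs_sawtooth_le t

lemma zetaR_eq_sawtooth {s : ℝ} (hs : 0 < s) (hs1 : s ≠ 1) :
    zetaR s = -(s / (1 - s)) - 1 / 2 - s * ∫ u in Ioi (1 : ℝ), sawtooth u * u ^ (-s - 1) := by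
  have h : (∫ u in Ioi (1 : ℝ), Int.fract u * u ^ (-s - 1)) =
      (∫ u in Ioi (1 : ℝ), sawtooth u * u ^ (-s - 1)) + 1 / (2 * s) := by
    have e : 1 / (2 * s) = ∫ u in Ioi (1 : ℝ), 1 / 2 * u ^ (-s - 1) := by
      rw [integral_const_mul, integral_Ioi_rpow_of_lt (by linarith) one_pos]
      simp only [sub_add_cancel, Real.one_rpow]
      field_simp
    rw [e, ← integral_add (integrableOn_sawtooth_mul_rpow hs)
      ((integrableOn_Ioi_rpow_of_lt (by linarith) one_pos).const_mul _)]
    refine setIntegral_congr_fun measurableSet_Ioi fun t _ => ?_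
    simp only [sawtooth]
    ring
  have h1 : s - 1 ≠ 0 := sub_ne_zero.mpr hs1
  have h2 : 1 - s ≠ 0 := sub_ne_zero.mpr hs1.symm
  rw [zetaR_eq hs hs1, h]
  have : s / (s - 1) = -(s / (1 - s)) := by rw [← div_neg, neg_sub]
  rw [this]
  field_simp
  ring

lemma powSum_eq_integral {s t : ℝ} (hs : 0 < s) (hs1 : s ≠ 1) (ht : 1 ≤ t) :
    powSum s t = t ^ (1 - s) / (1 - s) - s / (1 - s) - 1 / 2 - sawtooth t * t ^ (-s)
      - s * ∫ u in (1 : ℝ)..t, sawtooth u * u ^ (-s - 1) := by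
  have ht0 : 0 < t := one_pos.trans_le ht
  have h := sum_Icc_one_mul_eq_sub_integral (fun _ => 1) (f := fun u => u ^ (-s))
    (f' := fun u => -s * u ^ (-s - 1)) ht
    (fun u hu => Real.hasDerivAt_rpow_const (Or.inl (one_pos.trans_le hu.1).ne'))
    (continuousOn_const.mul (continuousOn_rpow_Icc _ one_pos))
  simp only [mul_one] at h
  have hI : (∫ u in (1 : ℝ)..t, -s * u ^ (-s - 1) * ∑ _k ∈ Finset.Icc 1 ⌊u⌋₊, (1 : ℝ)) =
      ∫ u in (1 : ℝ)..t,
        ((-s) * u ^ (-s) + s / 2 * u ^ (-s - 1) + s * (sawtooth u * u ^ (-s - 1))) := by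
    refine intervalIntegral.integral_congr fun u hu => ?_
    rw [uIcc_of_le ht] at hu
    have hu0 : 0 < u := one_pos.trans_le hu.1
    have e : u ^ (-s) = u * u ^ (-s - 1) := by
      rw [Real.rpow_sub_one hu0.ne']; field_simp
    simp only [sum_Icc_floor_one hu0.le, sawtooth, e]
    ring
  have i1 := intervalIntegrable_rpow_of_pos (-s) one_pos ht
  have i2 := intervalIntegrable_rpow_of_pos (-s - 1) one_pos ht
  have i3 := intervalIntegrable_sawtooth_mul_rpow one_pos ht (-s - 1)
  rw [sum_Icc_floor_one ht0.le, hI, intervalIntegral.integral_add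
      ((i1.const_mul _).add (i2.const_mul _)) (i3.const_mul _),
    intervalIntegral.integral_add (i1.const_mul _) (i2.const_mul _),
    intervalIntegral.integral_const_mul, intervalIntegral.integral_const_mul,
    intervalIntegral.integral_const_mul,
    integral_rpow_of_pos (fun h => hs1 (by linarith)) one_pos ht,
    integral_rpow_of_pos (by linarith) one_pos ht] at h
  simp only [Real.one_rpow, sub_add_cancel] at h
  rw [powSum, h]
  have e : t ^ (1 - s) = t * t ^ (-s) := by
    rw [sub_eq_add_neg, Real.rpow_add ht0, Real.rpow_one]
  have h2 : 1 - s ≠ 0 := sub_ne_zero.mpr hs1.symm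
  rw [show -s + 1 = 1 - s by ring, e, sawtooth]
  field_simp
  ring

/-- The exact formulas for `powSum` and `zetaR` differ only in the upper limit of the sawtooth
integral, so the error is `s ∫_t^∞ sawtooth u * u^(-s-1) du`, which oscillation makes as small as
`t^(-s-1)`. -/
theorem abs_powSum_sub_le {s : ℝ} (hs : 0 < s) (hs1 : s ≠ 1) {t : ℝ} (ht : 1 ≤ t) :
    |powSum s t - (t ^ (1 - s) / (1 - s) + zetaR s - sawtooth t * t ^ (-s))| ≤
      s * t ^ (-s - 1) := by
  have ht0 : 0 < t := one_pos.trans_le ht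
  rw [powSum_eq_integral hs hs1 ht, zetaR_eq_sawtooth hs hs1]
  set I := ∫ u in Ioi (1 : ℝ), sawtooth u * u ^ (-s - 1) with hI
  set J := ∫ u in (1 : ℝ)..t, sawtooth u * u ^ (-s - 1) with hJ
  have hlim : Tendsto (fun T : ℝ => |(∫ u in (1 : ℝ)..T, sawtooth u * u ^ (-s - 1)) - J|) atTop
      (𝓝 |I - J|) :=
    ((intervalIntegral_tendsto_integral_Ioi 1 (integrableOn_sawtooth_mul_rpow hs)
      tendsto_id).sub_const J).abs
  have hle : |I - J| ≤ t ^ (-s - 1) := by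
    refine le_of_tendsto hlim ?_
    filter_upwards [eventually_ge_atTop t] with T hT
    rw [hJ, intervalIntegral.integral_interval_sub_left
      (intervalIntegrable_sawtooth_mul_rpow one_pos (ht.trans hT) _)
      (intervalIntegrable_sawtooth_mul_rpow one_pos ht _)]
    have := abs_integral_sawtooth_mul_rpow_le ht0 hT (p := s + 1) (by linarith)
    rw [show -(s + 1) = -s - 1 by ring] at this
    have h0 := Real.rpow_pos_of_pos ht0 (-s - 1)
    linarith
  have e : t ^ (1 - s) / (1 - s) - s / (1 - s) - 1 / 2 - sawtooth t * t ^ (-s) - s * J -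
      (t ^ (1 - s) / (1 - s) + (-(s / (1 - s)) - 1 / 2 - s * I) - sawtooth t * t ^ (-s)) =
      s * (I - J) := by ring
  rw [e, abs_mul, abs_of_pos hs]
  gcongr

/-! ### Sums over lattice points under a hyperbola -/

lemma sum_Icc_divisorsAntidiagonal (φ : ℕ → ℕ → ℝ) (N : ℕ) :
    ∑ n ∈ Finset.Icc 1 N, ∑ p ∈ n.divisorsAntidiagonal, φ p.1 p.2 =
      ∑ i ∈ Finset.Icc 1 N, ∑ j ∈ Finset.Icc 1 (N / i), φ i j := by
  rw [Finset.sum_sigma', Finset.sum_sigma']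
  refine Finset.sum_bij' (fun p _ => (⟨p.2.1, p.2.2⟩ : Σ _ : ℕ, ℕ))
    (fun q _ => (⟨q.1 * q.2, (q.1, q.2)⟩ : Σ _ : ℕ, ℕ × ℕ)) ?_ ?_ ?_ ?_ ?_
  · rintro ⟨n, i, j⟩ h
    simp only [Finset.mem_sigma, Finset.mem_Icc, Nat.mem_divisorsAntidiagonal] at h ⊢
    obtain ⟨⟨h1, h2⟩, rfl, h3⟩ := h
    have hi : 1 ≤ i := Nat.one_le_iff_ne_zero.mpr (left_ne_zero_of_mul h3)
    have hj : 1 ≤ j := Nat.one_le_iff_ne_zero.mpr (right_ne_zero_of_mul h3)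
    exact ⟨⟨hi, (Nat.le_mul_of_pos_right i hj).trans h2⟩, hj,
      (Nat.le_div_iff_mul_le hi).mpr (by rwa [mul_comm])⟩
  · rintro ⟨i, j⟩ h
    simp only [Finset.mem_sigma, Finset.mem_Icc, Nat.mem_divisorsAntidiagonal] at h ⊢
    obtain ⟨⟨h1, h2⟩, h3, h4⟩ := h
    have h5 : i * j ≤ N := by
      rw [mul_comm]; exact (Nat.le_div_iff_mul_le h1).mp h4
    exact ⟨⟨Nat.mul_pos h1 h3, h5⟩, trivial, (Nat.mul_pos h1 h3).ne'⟩
  · rintro ⟨n, i, j⟩ h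
    simp only [Finset.mem_sigma, Finset.mem_Icc, Nat.mem_divisorsAntidiagonal] at h
    obtain ⟨-, rfl, -⟩ := h
    rfl
  · rintro ⟨i, j⟩ _
    rfl
  · rintro ⟨n, i, j⟩ _
    rfl

lemma sum_Icc_div_eq_sum_ite (φ : ℕ → ℕ → ℝ) (N i : ℕ) (hi : 1 ≤ i) :
    ∑ j ∈ Finset.Icc 1 (N / i), φ i j =
      ∑ j ∈ Finset.Icc 1 N, if i * j ≤ N then φ i j else 0 := by
  rw [← Finset.sum_filter]
  refine Finset.sum_congr ?_ fun _ _ => rfl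
  ext j
  simp only [Finset.mem_Icc, Finset.mem_filter, Nat.le_div_iff_mul_le hi, mul_comm j i]
  refine ⟨fun h => ⟨⟨h.1, (Nat.le_mul_of_pos_left j hi).trans h.2⟩, h.2⟩, fun h => ⟨h.1.1, h.2⟩⟩

lemma sum_Icc_eq_sum_ite {N R : ℕ} (hR : R ≤ N) (f : ℕ → ℝ) :
    ∑ i ∈ Finset.Icc 1 R, f i = ∑ i ∈ Finset.Icc 1 N, if i ≤ R then f i else 0 := by
  rw [← Finset.sum_filter]
  refine Finset.sum_congr ?_ fun _ _ => rfl
  ext j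
  simp only [Finset.mem_Icc, Finset.mem_filter]
  exact ⟨fun h => ⟨⟨h.1, h.2.trans hR⟩, h.2⟩, fun h => ⟨h.1.1, h.2⟩⟩

/-- Dirichlet's hyperbola method. -/
lemma sum_hyperbola (φ : ℕ → ℕ → ℝ) {N R : ℕ} (h1 : R * R ≤ N) (h2 : N < (R + 1) * (R + 1)) :
    ∑ i ∈ Finset.Icc 1 N, ∑ j ∈ Finset.Icc 1 (N / i), φ i j =
      (∑ j ∈ Finset.Icc 1 R, ∑ i ∈ Finset.Icc 1 (N / j), φ i j) +
      (∑ i ∈ Finset.Icc 1 R, ∑ j ∈ Finset.Icc 1 (N / i), φ i j) -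
      ∑ i ∈ Finset.Icc 1 R, ∑ j ∈ Finset.Icc 1 R, φ i j := by
  have hR : R ≤ N := (Nat.le_mul_self R).trans h1
  have e1 : ∀ M ≤ N, ∑ i ∈ Finset.Icc 1 M, ∑ j ∈ Finset.Icc 1 (N / i), φ i j =
      ∑ i ∈ Finset.Icc 1 M, ∑ j ∈ Finset.Icc 1 N, if i * j ≤ N then φ i j else 0 :=
    fun M _ => Finset.sum_congr rfl fun i hi =>
      sum_Icc_div_eq_sum_ite φ N i (Finset.mem_Icc.mp hi).1
  have e2 : ∑ j ∈ Finset.Icc 1 R, ∑ i ∈ Finset.Icc 1 (N / j), φ i j =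
      ∑ j ∈ Finset.Icc 1 R, ∑ i ∈ Finset.Icc 1 N, if i * j ≤ N then φ i j else 0 :=
    Finset.sum_congr rfl fun j hj => by
      rw [sum_Icc_div_eq_sum_ite (fun j i => φ i j) N j (Finset.mem_Icc.mp hj).1]
      simp only [mul_comm]
  rw [e1 N le_rfl, e1 R hR, e2, sum_Icc_eq_sum_ite hR, sum_Icc_eq_sum_ite hR, sum_Icc_eq_sum_ite hR]
  have e3 : ∀ i, (if i ≤ R then ∑ j ∈ Finset.Icc 1 R, φ i j else 0) =
      ∑ j ∈ Finset.Icc 1 N, if i ≤ R ∧ j ≤ R then φ i j else 0 := by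
    intro i
    split_ifs with h
    · simp only [h, true_and]
      exact sum_Icc_eq_sum_ite hR _
    · simp [h]
  have e4 : ∀ (i : ℕ) (f : ℕ → ℝ), (if i ≤ R then ∑ j ∈ Finset.Icc 1 N, f j else 0) =
      ∑ j ∈ Finset.Icc 1 N, if i ≤ R then f j else 0 := by
    intro i f; split_ifs <;> simp
  simp only [e3, e4]
  rw [Finset.sum_comm (f := fun j i => if j ≤ R then if i * j ≤ N then φ i j else 0 else 0),
    ← Finset.sum_add_distrib, ← Finset.sum_sub_distrib]
  refine Finset.sum_congr rfl fun i _ => ?_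
  rw [← Finset.sum_add_distrib, ← Finset.sum_sub_distrib]
  refine Finset.sum_congr rfl fun j _ => ?_
  by_cases hi : i ≤ R <;> by_cases hj : j ≤ R
  · have : i * j ≤ N := (Nat.mul_le_mul hi hj).trans h1
    simp [hi, hj, this]
  · simp [hi, hj]
  · simp [hi, hj]
  · have : ¬ i * j ≤ N := by
      push Not at hi hj ⊢
      exact h2.trans_le (Nat.mul_le_mul hi hj)
    simp [hi, hj, this]

/-! ### The operators `W ↦ ∑_{k ≤ x} c(k) W(x / k)` -/

/-- `∑_{k ≤ x} c(k) W(x / k)`. -/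
def dsum (c : ArithmeticFunction ℝ) (W : ℝ → ℝ) (x : ℝ) : ℝ :=
  ∑ k ∈ Finset.Icc 1 ⌊x⌋₊, c k * W (x / k)

/-- Convolution becomes composition because `⌊x/i⌋ = ⌊x⌋ / i` in integer division. Every later
manipulation of Möbius twists rests on this. -/
lemma dsum_mul (c d : ArithmeticFunction ℝ) (W : ℝ → ℝ) (x : ℝ) :
    dsum (c * d) W x = dsum c (dsum d W) x := by
  have h := sum_Icc_divisorsAntidiagonal (fun i j => c i * (d j * W (x / i / j))) ⌊x⌋₊
  simp only [dsum, Nat.floor_div_natCast, Finset.mul_sum]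
  rw [← h]
  refine Finset.sum_congr rfl fun n _ => ?_
  rw [ArithmeticFunction.mul_apply, Finset.sum_mul]
  refine Finset.sum_congr rfl fun p hp => ?_
  rw [← (Nat.mem_divisorsAntidiagonal.mp hp).1, Nat.cast_mul, div_div, mul_assoc]

lemma dsum_add (c : ArithmeticFunction ℝ) (V W : ℝ → ℝ) (x : ℝ) :
    dsum c (fun y => V y + W y) x = dsum c V x + dsum c W x := by
  simp only [dsum, mul_add, Finset.sum_add_distrib]

lemma dsum_sub (c : ArithmeticFunction ℝ) (V W : ℝ → ℝ) (x : ℝ) :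
    dsum c (fun y => V y - W y) x = dsum c V x - dsum c W x := by
  simp only [dsum, mul_sub, Finset.sum_sub_distrib]

lemma dsum_const_mul (c : ArithmeticFunction ℝ) (r : ℝ) (W : ℝ → ℝ) (x : ℝ) :
    dsum c (fun y => r * W y) x = r * dsum c W x := by
  simp only [dsum, Finset.mul_sum]
  exact Finset.sum_congr rfl fun _ _ => by ring

/-- Only arguments `x / k` with `k ≤ x` occur, so values below `1` are irrelevant. -/
lemma dsum_congr (c : ArithmeticFunction ℝ) {V W : ℝ → ℝ} {x : ℝ} (h : ∀ y, 1 ≤ y → V y = W y) :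
    dsum c V x = dsum c W x := by
  refine Finset.sum_congr rfl fun k hk => ?_
  rw [Finset.mem_Icc] at hk
  rw [h]
  have hx : (k : ℝ) ≤ x := (Nat.le_floor_iff' (by lia)).mp hk.2
  rwa [le_div_iff₀ (by exact_mod_cast hk.1), one_mul]

lemma dsum_one_one (c : ArithmeticFunction ℝ) (x : ℝ) :
    dsum c (fun _ => 1) x = ∑ k ∈ Finset.Icc 1 ⌊x⌋₊, c k := by
  simp [dsum]

lemma idPow_apply (a : ℝ) {n : ℕ} (hn : n ≠ 0) : idPow a n = (n : ℝ) ^ a := if_neg hn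

lemma idPow_apply_of_pos (a : ℝ) {n : ℕ} (hn : 1 ≤ n) : idPow a n = (n : ℝ) ^ a :=
  idPow_apply a (by lia)

lemma powSum_eq_sum_idPow (a t : ℝ) : powSum (-a) t = dsum (idPow a) (fun _ => 1) t := by
  rw [dsum_one_one, powSum, neg_neg]
  exact Finset.sum_congr rfl fun k hk => (idPow_apply_of_pos a (Finset.mem_Icc.mp hk).1).symm

/-- The hyperbola method for `∑_{ij ≤ u} j^a`, cut at `⌊√u⌋`, with `⌊u/d⌋` rewritten through the
sawtooth. -/
lemma sum_sigmaR_eq (a : ℝ) {u : ℝ} (hu : 1 ≤ u) :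
    ∑ n ∈ Finset.Icc 1 ⌊u⌋₊, sigmaR a n =
      (∑ d ∈ Finset.Icc 1 ⌊√u⌋₊, (d : ℝ) ^ a * (u / d - 1 / 2 - sawtooth (u / d))) +
      (∑ m ∈ Finset.Icc 1 ⌊√u⌋₊, powSum (-a) (u / m)) - ⌊√u⌋₊ * powSum (-a) ⌊√u⌋₊ := by
  have hu0 : 0 ≤ u := zero_le_one.trans hu
  have h1 : ⌊√u⌋₊ * ⌊√u⌋₊ ≤ ⌊u⌋₊ := by
    refine Nat.le_floor ?_
    push_cast
    calc (⌊√u⌋₊ : ℝ) * ⌊√u⌋₊ ≤ √u * √u :=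
          mul_self_le_mul_self (Nat.cast_nonneg _) (Nat.floor_le (Real.sqrt_nonneg u))
      _ = u := Real.mul_self_sqrt hu0
  have h2 : ⌊u⌋₊ < (⌊√u⌋₊ + 1) * (⌊√u⌋₊ + 1) := by
    refine (Nat.floor_lt hu0).mpr ?_
    push_cast
    calc u = √u * √u := (Real.mul_self_sqrt hu0).symm
      _ < _ := mul_self_lt_mul_self (Real.sqrt_nonneg u) (Nat.lt_floor_add_one _)
  have h := sum_Icc_divisorsAntidiagonal (fun _ j => (j : ℝ) ^ a) ⌊u⌋₊
  rw [sum_hyperbola _ h1 h2] at h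
  have h0 : ∑ n ∈ Finset.Icc 1 ⌊u⌋₊, sigmaR a n =
      ∑ n ∈ Finset.Icc 1 ⌊u⌋₊, ∑ p ∈ n.divisorsAntidiagonal, (p.2 : ℝ) ^ a := by
    refine Finset.sum_congr rfl fun n _ => ?_
    rw [sigmaR, ArithmeticFunction.mul_apply]
    refine Finset.sum_congr rfl fun p hp => ?_
    have hp' := Nat.mem_divisorsAntidiagonal.mp hp
    have hp1 : p.1 ≠ 0 := fun h => hp'.2 (by rw [← hp'.1, h, zero_mul])
    have hp2 : p.2 ≠ 0 := fun h => hp'.2 (by rw [← hp'.1, h, mul_zero])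
    simp [hp1, idPow_apply a hp2]
  rw [h0, h]
  congr 1
  · congr 1
    · refine Finset.sum_congr rfl fun d hd => ?_
      have := sum_Icc_floor_one (t := u / d) (by positivity)
      rw [Nat.floor_div_natCast] at this
      rw [sawtooth, show u / d - 1 / 2 - (Int.fract (u / d) - 1 / 2) = u / d - Int.fract (u / d) by
        ring, ← this, Finset.mul_sum]
      simp
    · refine Finset.sum_congr rfl fun m hm => ?_
      simp [powSum, Nat.floor_div_natCast]
  · simp [powSum]

/-! ### The error term `Δ_a` in terms of sawtooth sums -/

/-- The profile of the boundary terms in the hyperbola method. -/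
def hyperbolaProfile (a w : ℝ) : ℝ :=
  w ^ a / a - w ^ (-a) / (a * (1 + a)) - w ^ (2 + a) / (1 + a)

/-- The derivative of `hyperbolaProfile`. -/
def hyperbolaProfile' (a w : ℝ) : ℝ :=
  w ^ (a - 1) + w ^ (-a - 1) / (1 + a) - (2 + a) / (1 + a) * w ^ (1 + a)

/-- The profile and its derivative both vanish at `w = 1`. A bound `M` for the second derivative on
`[1/2, 1]` and the mean value inequality, used twice, give the linear and quadratic decay. -/
lemma hyperbolaProfile_bounds {a : ℝ} (ha : -1 < a) (ha' : a < 0) :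
    ∃ M, 0 ≤ M ∧ ∀ w ∈ Icc (1 / 2 : ℝ) 1,
      |hyperbolaProfile a w| ≤ M * (1 - w) ^ 2 ∧ |hyperbolaProfile' a w| ≤ M * (1 - w) := by
  have h1a : 1 + a ≠ 0 := by linarith
  have ha0 : a ≠ 0 := ha'.ne
  have hd1 : ∀ w : ℝ, 0 < w → HasDerivAt (hyperbolaProfile a) (hyperbolaProfile' a w) w := by
    intro w hw
    have := (((Real.hasDerivAt_rpow_const (p := a) (Or.inl hw.ne')).div_const a).sub
      ((Real.hasDerivAt_rpow_const (p := -a) (Or.inl hw.ne')).div_const (a * (1 + a)))).sub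
      ((Real.hasDerivAt_rpow_const (p := 2 + a) (Or.inl hw.ne')).div_const (1 + a))
    refine this.congr_deriv ?_
    rw [hyperbolaProfile', show 2 + a - 1 = 1 + a by ring]
    field_simp
    ring
  have hd2 : ∀ w : ℝ, 0 < w → HasDerivAt (hyperbolaProfile' a)
      ((a - 1) * w ^ (a - 2) - w ^ (-a - 2) - (2 + a) * w ^ a) w := by
    intro w hw
    have := ((Real.hasDerivAt_rpow_const (p := a - 1) (Or.inl hw.ne')).add
      ((Real.hasDerivAt_rpow_const (p := -a - 1) (Or.inl hw.ne')).div_const (1 + a))).sub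
      ((Real.hasDerivAt_rpow_const (p := 1 + a) (Or.inl hw.ne')).const_mul ((2 + a) / (1 + a)))
    refine this.congr_deriv ?_
    rw [show 1 + a - 1 = a by ring, show a - 1 - 1 = a - 2 by ring,
      show -a - 1 - 1 = -a - 2 by ring]
    field_simp
    ring
  have hc : ContinuousOn (fun w : ℝ => (a - 1) * w ^ (a - 2) - w ^ (-a - 2) - (2 + a) * w ^ a)
      (Icc (1 / 2) 1) := by
    have h := fun q => continuousOn_rpow_Icc q (α := 1 / 2) (β := 1) (by norm_num)
    exact ((continuousOn_const.mul (h _)).sub (h _)).sub (continuousOn_const.mul (h _))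
  obtain ⟨M, hM⟩ := isCompact_Icc.exists_bound_of_continuousOn hc
  have hM0 : 0 ≤ M := (norm_nonneg _).trans (hM 1 (by constructor <;> norm_num))
  have b2 : ∀ w ∈ Icc (1 / 2 : ℝ) 1, |hyperbolaProfile' a w| ≤ M * (1 - w) := by
    intro w hw
    have := (convex_Icc w 1).norm_image_sub_le_of_norm_hasDerivWithin_le (C := M)
      (f := hyperbolaProfile' a) (x := 1) (y := w)
      (fun z hz => (hd2 z (by linarith [hw.1, hz.1])).hasDerivWithinAt)
      (fun z hz => hM z ⟨hw.1.trans hz.1, hz.2⟩) ⟨hw.2, le_rfl⟩ ⟨le_rfl, hw.2⟩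
    have h1 : hyperbolaProfile' a 1 = 0 := by
      simp only [hyperbolaProfile', Real.one_rpow]; field_simp; ring
    rwa [h1, sub_zero, Real.norm_eq_abs, Real.norm_eq_abs, abs_sub_comm,
      abs_of_nonneg (sub_nonneg.mpr hw.2)] at this
  refine ⟨M, hM0, fun w hw => ⟨?_, b2 w hw⟩⟩
  have := (convex_Icc w 1).norm_image_sub_le_of_norm_hasDerivWithin_le (C := M * (1 - w))
    (f := hyperbolaProfile a) (x := 1) (y := w)
    (fun z hz => (hd1 z (by linarith [hw.1, hz.1])).hasDerivWithinAt)
    (fun z hz => (b2 z ⟨hw.1.trans hz.1, hz.2⟩).trans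
      (mul_le_mul_of_nonneg_left (by linarith [hz.1]) hM0)) ⟨hw.2, le_rfl⟩ ⟨le_rfl, hw.2⟩
  have h1 : hyperbolaProfile a 1 = 0 := by
    simp only [hyperbolaProfile, Real.one_rpow]; field_simp; ring
  rw [h1, sub_zero, Real.norm_eq_abs, Real.norm_eq_abs, abs_sub_comm,
    abs_of_nonneg (sub_nonneg.mpr hw.2)] at this
  rw [pow_two, ← mul_assoc]
  exact this

/-- At an integer the sawtooth equals `-1/2`, whence the term `n^(-s)/2`. -/
lemma abs_powSum_natCast_sub_le {s : ℝ} (hs : 0 < s) (hs1 : s ≠ 1) {n : ℕ} (hn : 1 ≤ n) :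
    |powSum s n - ((n : ℝ) ^ (1 - s) / (1 - s) + zetaR s + (n : ℝ) ^ (-s) / 2)| ≤
      s * (n : ℝ) ^ (-s - 1) := by
  have := abs_powSum_sub_le hs hs1 (t := n) (by exact_mod_cast hn)
  have h0 : sawtooth n = -(1 / 2) := by simp [sawtooth]
  rw [h0] at this
  convert! this using 3
  ring

/-- The two sawtooth sums that make up `-Δ_a(u)` up to a small error. -/
def sawtoothSum (a u : ℝ) : ℝ :=
  (∑ d ∈ Finset.Icc 1 ⌊√u⌋₊, (d : ℝ) ^ a * sawtooth (u / d)) +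
    ∑ m ∈ Finset.Icc 1 ⌊√u⌋₊, (u / m) ^ a * sawtooth (u / m)

/-- Put `R = ⌊√u⌋`. For `m ≤ R` one has `u/m ≥ R`, so each of the `R` Euler-Maclaurin errors is at
most `R^(a-1)`. -/
lemma abs_sum_powSum_div_sub_le {a : ℝ} (ha : -1 < a) (ha' : a < 0) {u : ℝ} (hu : 1 ≤ u) :
    |(∑ m ∈ Finset.Icc 1 ⌊√u⌋₊, powSum (-a) (u / m)) -
      (u ^ (1 + a) / (1 + a) * powSum (1 + a) ⌊√u⌋₊ + ⌊√u⌋₊ * zetaR (-a) -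
        ∑ m ∈ Finset.Icc 1 ⌊√u⌋₊, (u / m) ^ a * sawtooth (u / m))| ≤ (⌊√u⌋₊ : ℝ) ^ a := by
  have hu0 : 0 < u := one_pos.trans_le hu
  have hv1 : 1 ≤ √u := Real.one_le_sqrt.mpr hu
  have hR : 1 ≤ ⌊√u⌋₊ := (Nat.one_le_floor_iff _).mpr hv1
  have hR0 : (0 : ℝ) < ⌊√u⌋₊ := by exact_mod_cast hR
  have hRv : (⌊√u⌋₊ : ℝ) ≤ √u := Nat.floor_le (Real.sqrt_nonneg u)
  have e : (∑ m ∈ Finset.Icc 1 ⌊√u⌋₊, powSum (-a) (u / m)) -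
      (u ^ (1 + a) / (1 + a) * powSum (1 + a) ⌊√u⌋₊ + ⌊√u⌋₊ * zetaR (-a) -
        ∑ m ∈ Finset.Icc 1 ⌊√u⌋₊, (u / m) ^ a * sawtooth (u / m)) =
      ∑ m ∈ Finset.Icc 1 ⌊√u⌋₊, (powSum (-a) (u / m) - ((u / m) ^ (1 - -a) / (1 - -a) + zetaR (-a)
        - sawtooth (u / m) * (u / m) ^ (- -a))) := by
    rw [Finset.sum_sub_distrib, Finset.sum_sub_distrib, Finset.sum_add_distrib, powSum,
      Nat.floor_natCast, Finset.mul_sum]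
    simp only [neg_neg, sub_neg_eq_add, Finset.sum_const, Nat.card_Icc, add_tsub_cancel_right,
      nsmul_eq_mul]
    congr 2
    · congr 1
      refine Finset.sum_congr rfl fun m hm => ?_
      have hm0 : (0 : ℝ) < m := by exact_mod_cast (Finset.mem_Icc.mp hm).1
      rw [Real.div_rpow hu0.le hm0.le, Real.rpow_neg hm0.le]
      field_simp
    · exact Finset.sum_congr rfl fun m _ => mul_comm _ _
  rw [e]
  refine (Finset.abs_sum_le_sum_abs _ _).trans ?_
  have hb : ∀ m ∈ Finset.Icc 1 ⌊√u⌋₊, |powSum (-a) (u / m) - ((u / m) ^ (1 - -a) / (1 - -a) +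
      zetaR (-a) - sawtooth (u / m) * (u / m) ^ (- -a))| ≤ (⌊√u⌋₊ : ℝ) ^ (a - 1) := by
    intro m hm
    rw [Finset.mem_Icc] at hm
    have hm0 : (0 : ℝ) < m := by exact_mod_cast hm.1
    have hmR : (m : ℝ) ≤ ⌊√u⌋₊ := by exact_mod_cast hm.2
    have hRu : (⌊√u⌋₊ : ℝ) ≤ u / m := by
      rw [le_div_iff₀ hm0]
      calc (⌊√u⌋₊ : ℝ) * m ≤ √u * √u :=
            mul_le_mul hRv (hmR.trans hRv) hm0.le (Real.sqrt_nonneg u)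
        _ = u := Real.mul_self_sqrt hu0.le
    have hR1 : (1 : ℝ) ≤ ⌊√u⌋₊ := by exact_mod_cast hR
    refine (abs_powSum_sub_le (neg_pos.mpr ha') (by linarith) (hR1.trans hRu)).trans ?_
    rw [neg_neg]
    calc -a * (u / m) ^ (a - 1) ≤ 1 * (u / m) ^ (a - 1) := by
          gcongr; linarith
      _ ≤ _ := by
          rw [one_mul]
          exact Real.rpow_le_rpow_of_nonpos hR0 hRu (by linarith)
  refine (Finset.sum_le_sum hb).trans ?_
  rw [Finset.sum_const, Nat.card_Icc, add_tsub_cancel_right, nsmul_eq_mul,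
    Real.rpow_sub_one hR0.ne']
  field_simp
  exact le_rfl

/-- The real-variable estimate behind the hyperbola method: `v = √u`, `n = ⌊v⌋`. -/
lemma hyperbola_remainder_le {a M u v n : ℝ} (ha : -1 < a) (ha' : a < 0) (hM0 : 0 ≤ M)
    (hM : ∀ w ∈ Icc (1 / 2 : ℝ) 1,
      |hyperbolaProfile a w| ≤ M * (1 - w) ^ 2 ∧ |hyperbolaProfile' a w| ≤ M * (1 - w))
    (hn1 : 1 ≤ n) (hnv : n ≤ v) (hvn : v < n + 1) (huv : u = v ^ 2) {e1 e2 e3 e4 : ℝ}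
    (h1 : |e1| ≤ (1 - a) * n ^ (a - 2)) (h2 : |e2| ≤ -a * n ^ (a - 1))
    (h3 : |e3| ≤ (1 + a) * n ^ (-a - 2)) (h4 : |e4| ≤ n ^ a) :
    |(u * n ^ a / a - u ^ (1 + a) * n ^ (-a) / (a * (1 + a)) - n * n ^ (1 + a) / (1 + a)) +
      1 / 2 * (u * n ^ (a - 1) + u ^ (1 + a) * n ^ (-a - 1) / (1 + a) -
        (2 + a) / (1 + a) * n ^ (1 + a)) -
      1 / 4 * n ^ a + u * e1 - (n + 1 / 2) * e2 + u ^ (1 + a) / (1 + a) * e3 + e4| ≤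
      (2 * M + 40) * u ^ (a / 2) := by
  have hn0 : 0 < n := one_pos.trans_le hn1
  have hv0 : 0 < v := hn0.trans_le hnv
  have h1a : 0 < 1 + a := by linarith
  have hu0 : 0 < u := by rw [huv]; positivity
  have hua : u ^ (1 + a) = v ^ (2 + 2 * a) := by
    rw [huv, ← Real.rpow_natCast, ← Real.rpow_mul hv0.le]; congr 1; push_cast; ring
  have hva : u ^ (a / 2) = v ^ a := by
    rw [huv, ← Real.rpow_natCast, ← Real.rpow_mul hv0.le]; congr 1; push_cast; ring
  have hv2 : v ^ (2 + a) = v ^ 2 * v ^ a := by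
    rw [Real.rpow_add hv0]; norm_cast
  have K1 : u * n ^ a / a - u ^ (1 + a) * n ^ (-a) / (a * (1 + a)) - n * n ^ (1 + a) / (1 + a) =
      v ^ (2 + a) * hyperbolaProfile a (n / v) := by
    have t1 : v ^ (2 + a) * (n / v) ^ a = u * n ^ a := by
      rw [Real.div_rpow hn0.le hv0.le, hv2, huv]
      field_simp
    have t2 : v ^ (2 + a) * (n / v) ^ (-a) = u ^ (1 + a) * n ^ (-a) := by
      rw [Real.div_rpow hn0.le hv0.le, hua, show 2 + 2 * a = (2 + a) - (-a) by ring,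
        Real.rpow_sub hv0]
      field_simp
    have t3 : v ^ (2 + a) * (n / v) ^ (2 + a) = n * n ^ (1 + a) := by
      rw [Real.div_rpow hn0.le hv0.le, show 2 + a = 1 + (1 + a) by ring, Real.rpow_add hn0,
        Real.rpow_one]
      field_simp
    rw [← t1, ← t2, ← t3, hyperbolaProfile]
    ring
  have K2 : u * n ^ (a - 1) + u ^ (1 + a) * n ^ (-a - 1) / (1 + a) -
      (2 + a) / (1 + a) * n ^ (1 + a) = v ^ (1 + a) * hyperbolaProfile' a (n / v) := by
    have t1 : v ^ (1 + a) * (n / v) ^ (a - 1) = u * n ^ (a - 1) := by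
      rw [Real.div_rpow hn0.le hv0.le, show 1 + a = 2 + (a - 1) by ring, Real.rpow_add hv0, huv]
      norm_cast
      field_simp
    have t2 : v ^ (1 + a) * (n / v) ^ (-a - 1) = u ^ (1 + a) * n ^ (-a - 1) := by
      rw [Real.div_rpow hn0.le hv0.le, hua, show 2 + 2 * a = (1 + a) - (-a - 1) by ring,
        Real.rpow_sub hv0 (1 + a) (-a - 1)]
      ring
    have t3 : v ^ (1 + a) * (n / v) ^ (1 + a) = n ^ (1 + a) := by
      rw [Real.div_rpow hn0.le hv0.le]
      field_simp
    rw [← t1, ← t2, ← t3, hyperbolaProfile']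
    ring
  rw [K1, K2, hva]
  have hv2n : v ≤ 2 * n := by linarith
  have hw : n / v ∈ Icc (1 / 2 : ℝ) 1 := by
    constructor
    · rw [div_le_div_iff₀ two_pos hv0]; linarith
    · exact (div_le_one hv0).mpr hnv
  -- The ratio `n/v` is within `1/v` of the zero of the profile, so the factors `v^(2+a)` and
  -- `v^(1+a)` both drop to `v^a`.
  have hw1 : 1 - n / v ≤ 1 / v := by
    rw [one_sub_div hv0.ne']
    gcongr; linarith
  have hw0 : 0 ≤ 1 - n / v := sub_nonneg.mpr hw.2
  have b1 : |v ^ (2 + a) * hyperbolaProfile a (n / v)| ≤ M * v ^ a := by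
    rw [abs_mul, abs_of_pos (Real.rpow_pos_of_pos hv0 _)]
    calc v ^ (2 + a) * |hyperbolaProfile a (n / v)| ≤ v ^ (2 + a) * (M * (1 / v) ^ 2) := by
          gcongr
          exact (hM _ hw).1.trans (by gcongr)
      _ = M * v ^ a := by rw [hv2]; field_simp
  have b2 : |v ^ (1 + a) * hyperbolaProfile' a (n / v)| ≤ M * v ^ a := by
    rw [abs_mul, abs_of_pos (Real.rpow_pos_of_pos hv0 _)]
    calc v ^ (1 + a) * |hyperbolaProfile' a (n / v)| ≤ v ^ (1 + a) * (M * (1 / v)) := by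
          gcongr
          exact (hM _ hw).2.trans (by gcongr)
      _ = M * v ^ a := by rw [Real.rpow_add hv0, Real.rpow_one]; field_simp
  have hna : n ^ a ≤ 2 * v ^ a := by
    calc n ^ a ≤ (v / 2) ^ a := Real.rpow_le_rpow_of_nonpos (by positivity) (by linarith) ha'.le
      _ = 2 ^ (-a) * v ^ a := by
          rw [Real.div_rpow hv0.le two_pos.le, Real.rpow_neg two_pos.le]; ring
      _ ≤ 2 * v ^ a := by
          gcongr
          calc (2 : ℝ) ^ (-a) ≤ 2 ^ (1 : ℝ) :=
                Real.rpow_le_rpow_of_exponent_le one_le_two (by linarith)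
            _ = 2 := Real.rpow_one 2
  have hnp := Real.rpow_pos_of_pos hn0 a
  have hu4 : u ≤ 4 * n ^ 2 := by rw [huv]; nlinarith
  have b3 : |u * e1| ≤ 8 * n ^ a := by
    rw [abs_mul, abs_of_pos hu0]
    calc u * |e1| ≤ (4 * n ^ 2) * (2 * n ^ (a - 2)) := by
          gcongr
          exact h1.trans (by gcongr; linarith)
      _ = 8 * n ^ a := by
          rw [Real.rpow_sub hn0]; norm_cast; field_simp; norm_num
  have b4 : |(n + 1 / 2) * e2| ≤ 2 * n ^ a := by
    rw [abs_mul, abs_of_pos (by positivity)]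
    calc (n + 1 / 2) * |e2| ≤ (2 * n) * (1 * n ^ (a - 1)) := by
          gcongr
          · linarith
          · exact h2.trans (by gcongr; linarith)
      _ = 2 * n ^ a := by
          rw [Real.rpow_sub hn0, Real.rpow_one]; field_simp
  have b5 : |u ^ (1 + a) / (1 + a) * e3| ≤ 4 * n ^ a := by
    rw [abs_mul, abs_of_pos (by positivity)]
    have hu' : u ^ (1 + a) ≤ 4 * n ^ (2 + 2 * a) := by
      calc u ^ (1 + a) ≤ (4 * n ^ 2) ^ (1 + a) := by gcongr
        _ = 4 ^ (1 + a) * n ^ (2 + 2 * a) := by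
            rw [Real.mul_rpow (by norm_num) (by positivity), ← Real.rpow_natCast,
              ← Real.rpow_mul hn0.le]
            congr 2; push_cast; ring
        _ ≤ 4 * n ^ (2 + 2 * a) := by
            gcongr
            calc (4 : ℝ) ^ (1 + a) ≤ 4 ^ (1 : ℝ) :=
                  Real.rpow_le_rpow_of_exponent_le (by norm_num) (by linarith)
              _ = 4 := Real.rpow_one 4
    calc u ^ (1 + a) / (1 + a) * |e3| ≤
          4 * n ^ (2 + 2 * a) / (1 + a) * ((1 + a) * n ^ (-a - 2)) := by gcongr
      _ = 4 * (n ^ (2 + 2 * a) * n ^ (-a - 2)) := by field_simp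
      _ = 4 * n ^ a := by rw [← Real.rpow_add hn0]; congr 2; ring
  have hMv : 0 ≤ M * v ^ a := mul_nonneg hM0 (Real.rpow_nonneg hv0.le _)
  -- The pieces add up to `3M/2 * v^a` plus `(1/4 + 8 + 2 + 4 + 1) n^a`, and `n^a ≤ 2 v^a`; the
  -- constant `2M + 40` leaves room.
  rw [abs_le] at b1 b2 b3 b4 b5 h4 ⊢
  constructor <;> linarith

theorem abs_Delta_add_sawtoothSum_le {a : ℝ} (ha : -1 < a) (ha' : a < 0) :
    ∃ C, ∀ u, 1 ≤ u → |Delta a u + sawtoothSum a u| ≤ C * u ^ (a / 2) := by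
  obtain ⟨M, hM0, hM⟩ := hyperbolaProfile_bounds ha ha'
  refine ⟨2 * M + 40, fun u hu => ?_⟩
  have hu0 : 0 < u := one_pos.trans_le hu
  have hv1 : 1 ≤ √u := Real.one_le_sqrt.mpr hu
  have hR : 1 ≤ ⌊√u⌋₊ := (Nat.one_le_floor_iff _).mpr hv1
  have hE := abs_sum_powSum_div_sub_le ha ha' hu
  have hS := sum_sigmaR_eq a hu
  have hq1 := abs_powSum_natCast_sub_le (s := 1 - a) (by linarith) (by linarith) hR
  have hq2 := abs_powSum_natCast_sub_le (s := -a) (by linarith) (by linarith) hR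
  have hq3 := abs_powSum_natCast_sub_le (s := 1 + a) (by linarith) (by linarith) hR
  have hsum : (∑ d ∈ Finset.Icc 1 ⌊√u⌋₊, (d : ℝ) ^ a * (u / d - 1 / 2 - sawtooth (u / d))) =
      u * powSum (1 - a) ⌊√u⌋₊ - 1 / 2 * powSum (-a) ⌊√u⌋₊ -
        ∑ d ∈ Finset.Icc 1 ⌊√u⌋₊, (d : ℝ) ^ a * sawtooth (u / d) := by
    rw [powSum, powSum, Nat.floor_natCast, Finset.mul_sum, Finset.mul_sum,
      ← Finset.sum_sub_distrib, ← Finset.sum_sub_distrib]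
    refine Finset.sum_congr rfl fun d hd => ?_
    have hd0 : (0 : ℝ) < d := by exact_mod_cast (Finset.mem_Icc.mp hd).1
    rw [neg_neg, show -(1 - a) = a - 1 by ring, Real.rpow_sub_one hd0.ne']
    field_simp
  rw [hsum] at hS
  have hRv : (⌊√u⌋₊ : ℝ) ≤ √u := Nat.floor_le (Real.sqrt_nonneg u)
  have hRv' : √u < ⌊√u⌋₊ + 1 := Nat.lt_floor_add_one _
  have hn1 : (1 : ℝ) ≤ ⌊√u⌋₊ := by exact_mod_cast hR
  rw [Delta, sawtoothSum, hS]
  have huv : u = √u ^ 2 := (Real.sq_sqrt hu0.le).symm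
  generalize (∑ d ∈ Finset.Icc 1 ⌊√u⌋₊, (d : ℝ) ^ a * sawtooth (u / d)) = A1 at *
  generalize (∑ m ∈ Finset.Icc 1 ⌊√u⌋₊, (u / m) ^ a * sawtooth (u / m)) = A2 at *
  generalize (∑ m ∈ Finset.Icc 1 ⌊√u⌋₊, powSum (-a) (u / m)) = A3 at *
  generalize powSum (1 - a) ⌊√u⌋₊ = q1 at *
  generalize powSum (-a) ⌊√u⌋₊ = q2 at *
  generalize powSum (1 + a) ⌊√u⌋₊ = q3 at *
  generalize (⌊√u⌋₊ : ℝ) = n at *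
  generalize √u = v at *
  rw [show 1 - (1 - a) = a by ring, show -(1 - a) - 1 = a - 2 by ring,
    show -(1 - a) = a - 1 by ring] at hq1
  rw [neg_neg, sub_neg_eq_add] at hq2
  rw [show 1 - (1 + a) = -a by ring, show -(1 + a) - 1 = -a - 2 by ring,
    show -(1 + a) = -a - 1 by ring] at hq3
  have hn0 : 0 < n := one_pos.trans_le hn1
  have h1a : 1 + a ≠ 0 := by linarith
  have ha0 : a ≠ 0 := ha'.ne
  have hnn : n * n ^ a = n ^ (1 + a) := by rw [Real.rpow_add hn0, Real.rpow_one]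
  -- All zeta values cancel against the main terms in `Delta`. What remains are the boundary terms
  -- in `n`, `v` and the errors `e1`, ..., `e4`, which unification reads off from `hq1`, `hq2`,
  -- `hq3`, `hE`.
  refine le_of_eq_of_le ?_ (hyperbola_remainder_le ha ha' hM0 hM hn1 hRv hRv' huv hq1 hq2 hq3 hE)
  congr 1
  field_simp
  linear_combination (-(8 * a + 8 * a ^ 2)) * hnn

/-! ### The logarithmic mean of `σ_a` -/

lemma powSum_le_of_one_lt {s : ℝ} (hs : 1 < s) : ∃ K, 0 ≤ K ∧ ∀ t, powSum s t ≤ K := by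
  refine ⟨∑' n : ℕ, (n : ℝ) ^ (-s), tsum_nonneg fun n => by positivity, fun t => ?_⟩
  exact (Real.summable_nat_rpow.mpr (by linarith)).sum_le_tsum _ fun n _ => by positivity

/-- The condition `d ≤ √u` is `d² ≤ u`; trading the variable range for an indicator allows the sum
and the integral over `u` to be exchanged. -/
lemma sum_Icc_floor_sqrt_eq {y u : ℝ} (hu : 1 ≤ u) (huy : u ≤ y) (g : ℕ → ℝ → ℝ) :
    ∑ d ∈ Finset.Icc 1 ⌊√u⌋₊, g d u =
      ∑ d ∈ Finset.Icc 1 ⌊√y⌋₊, (Ici ((d : ℝ) ^ 2)).indicator (g d) u := by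
  have hR : ⌊√u⌋₊ ≤ ⌊√y⌋₊ := Nat.floor_le_floor (Real.sqrt_le_sqrt huy)
  rw [sum_Icc_eq_sum_ite hR]
  refine Finset.sum_congr rfl fun d _ => ?_
  have h : d ≤ ⌊√u⌋₊ ↔ u ∈ Ici ((d : ℝ) ^ 2) := by
    rw [Nat.le_floor_iff (Real.sqrt_nonneg u), Real.le_sqrt (Nat.cast_nonneg d)
      (zero_le_one.trans hu), mem_Ici]
  by_cases hm : u ∈ Ici ((d : ℝ) ^ 2)
  · rw [indicator_of_mem hm, if_pos (h.mpr hm)]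
  · rw [indicator_of_notMem hm, if_neg (mt h.mp hm)]

lemma integral_indicator_Ici {c y : ℝ} (hc : 1 ≤ c) (hcy : c ≤ y) (g : ℝ → ℝ) :
    ∫ u in (1 : ℝ)..y, (Ici c).indicator g u = ∫ u in c..y, g u := by
  rw [intervalIntegral.integral_of_le (hc.trans hcy), intervalIntegral.integral_of_le hcy,
    setIntegral_indicator measurableSet_Ici]
  have h : (Ioc 1 y ∩ Ici c : Set ℝ) =ᵐ[volume] (Ioc 1 y ∩ Ioi c : Set ℝ) :=
    (ae_eq_refl _).inter Ioi_ae_eq_Ici.symm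
  rw [setIntegral_congr_set h]
  congr 2
  ext u
  simp only [mem_inter_iff, mem_Ioc, mem_Ioi]
  exact ⟨fun h => ⟨h.2, h.1.2⟩, fun h => ⟨⟨hc.trans_lt h.1, h.2⟩, h.1⟩⟩

lemma intervalIntegrable_indicator_Ici {c y : ℝ} {g : ℝ → ℝ}
    (hg : IntervalIntegrable g volume 1 y) :
    IntervalIntegrable ((Ici c).indicator g) volume 1 y :=
  ⟨hg.1.indicator measurableSet_Ici, hg.2.indicator measurableSet_Ici⟩

lemma intervalIntegrable_sum_floor_sqrt {y : ℝ} (hy : 1 ≤ y) {g : ℕ → ℝ → ℝ}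
    (hg : ∀ d, 1 ≤ d → IntervalIntegrable (g d) volume 1 y) :
    IntervalIntegrable (fun u => ∑ d ∈ Finset.Icc 1 ⌊√u⌋₊, g d u) volume 1 y := by
  have h : IntervalIntegrable (∑ d ∈ Finset.Icc 1 ⌊√y⌋₊, (Ici ((d : ℝ) ^ 2)).indicator (g d))
      volume 1 y := IntervalIntegrable.sum _ fun d hd =>
        intervalIntegrable_indicator_Ici (hg d (Finset.mem_Icc.mp hd).1)
  refine h.congr ?_
  intro u hu
  rw [uIoc_of_le hy] at hu
  simp only [Finset.sum_apply]
  exact (sum_Icc_floor_sqrt_eq hu.1.le hu.2 g).symm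

lemma integral_sum_floor_sqrt {y : ℝ} (hy : 1 ≤ y) {g : ℕ → ℝ → ℝ}
    (hg : ∀ d, 1 ≤ d → IntervalIntegrable (g d) volume 1 y) :
    ∫ u in (1 : ℝ)..y, ∑ d ∈ Finset.Icc 1 ⌊√u⌋₊, g d u =
      ∑ d ∈ Finset.Icc 1 ⌊√y⌋₊, ∫ u in ((d : ℝ) ^ 2)..y, g d u := by
  have h1 : ∫ u in (1 : ℝ)..y, ∑ d ∈ Finset.Icc 1 ⌊√u⌋₊, g d u =
      ∫ u in (1 : ℝ)..y, ∑ d ∈ Finset.Icc 1 ⌊√y⌋₊, (Ici ((d : ℝ) ^ 2)).indicator (g d) u := by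
    refine intervalIntegral.integral_congr fun u hu => ?_
    rw [uIcc_of_le hy] at hu
    exact sum_Icc_floor_sqrt_eq hu.1 hu.2 g
  rw [h1, intervalIntegral.integral_finsetSum fun d hd =>
    intervalIntegrable_indicator_Ici (hg d (Finset.mem_Icc.mp hd).1)]
  refine Finset.sum_congr rfl fun d hd => ?_
  rw [Finset.mem_Icc, Nat.le_floor_iff (Real.sqrt_nonneg y), Real.le_sqrt (Nat.cast_nonneg d)
    (zero_le_one.trans hy)] at hd
  exact integral_indicator_Ici (one_le_pow₀ (by exact_mod_cast hd.1)) hd.2 _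

lemma intervalIntegrable_sawtooth_div_mul {y c : ℝ} {f : ℝ → ℝ} (hf : ContinuousOn f (uIcc 1 y)) :
    IntervalIntegrable (fun u => f u * sawtooth (u / c)) volume 1 y := by
  have h : IntervalIntegrable (fun u => sawtooth (u / c)) volume 1 y := by
    refine (intervalIntegrable_const (c := (1 / 2 : ℝ))).mono_fun
      (measurable_sawtooth.comp (measurable_id.div_const c)).aestronglyMeasurable ?_
    filter_upwards with t
    simpa using abs_sawtooth_le (t / c)
  exact h.continuousOn_mul hf

/-- After the substitution `u = d t` the terms of the sawtooth sums become `∫ ψ(t) t^(-p)`. -/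
lemma abs_integral_sawtooth_div_le {d y p : ℝ} (hd : 0 < d) (hdy : d ^ 2 ≤ y) (hp : 0 < p) :
    |∫ u in (d ^ 2)..y, (u / d) ^ (-p) * sawtooth (u / d)| ≤ d * d ^ (-p) := by
  have h := intervalIntegral.integral_comp_div (a := d ^ 2) (b := y)
    (fun t => t ^ (-p) * sawtooth t) hd.ne'
  rw [h, smul_eq_mul, abs_mul, abs_of_pos hd]
  have e : d ^ 2 / d = d := by field_simp
  have h2 := abs_integral_sawtooth_mul_rpow_le hd (β := y / d)
    (by rw [le_div_iff₀ hd]; nlinarith) hp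
  simp only [mul_comm (sawtooth _)] at h2
  rw [e]
  have := Real.rpow_pos_of_pos hd (-p)
  gcongr
  linarith

lemma intervalIntegrable_inv_mul_sawtoothSum (a : ℝ) {y : ℝ} (hy : 1 ≤ y) :
    IntervalIntegrable (fun u => u⁻¹ * sawtoothSum a u) volume 1 y ∧
    ∫ u in (1 : ℝ)..y, u⁻¹ * sawtoothSum a u =
      (∑ d ∈ Finset.Icc 1 ⌊√y⌋₊, ∫ u in ((d : ℝ) ^ 2)..y, u⁻¹ * (d : ℝ) ^ a * sawtooth (u / d)) +
      ∑ d ∈ Finset.Icc 1 ⌊√y⌋₊, ∫ u in ((d : ℝ) ^ 2)..y, u⁻¹ * (u / d) ^ a * sawtooth (u / d) := by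
  have hinv : ContinuousOn (fun u : ℝ => u⁻¹) (uIcc 1 y) := by
    rw [uIcc_of_le hy]
    exact continuousOn_id.inv₀ fun u hu => (one_pos.trans_le hu.1).ne'
  have hg1 : ∀ d : ℕ, 1 ≤ d → IntervalIntegrable
      (fun u => u⁻¹ * (d : ℝ) ^ a * sawtooth (u / d)) volume 1 y := fun d _ =>
    intervalIntegrable_sawtooth_div_mul (hinv.mul continuousOn_const)
  have hg2 : ∀ d : ℕ, 1 ≤ d → IntervalIntegrable
      (fun u => u⁻¹ * (u / d) ^ a * sawtooth (u / d)) volume 1 y := fun d hd => by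
    refine intervalIntegrable_sawtooth_div_mul (hinv.mul ?_)
    refine (continuousOn_id.div_const _).rpow_const fun u hu => Or.inl ?_
    rw [uIcc_of_le hy] at hu
    have : (0 : ℝ) < d := by exact_mod_cast hd
    exact (div_pos (one_pos.trans_le hu.1) this).ne'
  have i1 := intervalIntegrable_sum_floor_sqrt hy hg1
  have i2 := intervalIntegrable_sum_floor_sqrt hy hg2
  have e : (fun u => u⁻¹ * sawtoothSum a u) = fun u =>
      (∑ d ∈ Finset.Icc 1 ⌊√u⌋₊, u⁻¹ * (d : ℝ) ^ a * sawtooth (u / d)) +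
      ∑ d ∈ Finset.Icc 1 ⌊√u⌋₊, u⁻¹ * (u / d) ^ a * sawtooth (u / d) := by
    ext u
    simp only [sawtoothSum, mul_add, Finset.mul_sum, mul_assoc]
  rw [e]
  refine ⟨i1.add i2, ?_⟩
  rw [intervalIntegral.integral_add i1 i2, integral_sum_floor_sqrt hy hg1,
    integral_sum_floor_sqrt hy hg2]

/-- Both families of terms integrate to at most `d^(a-1)`, and `∑ d^(a-1)` converges since `a < 0`.
Bounding `sawtoothSum` pointwise would not give this. -/
lemma abs_integral_sawtoothSum_le {a : ℝ} (ha' : a < 0) :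
    ∃ C, ∀ y, 1 ≤ y → |∫ u in (1 : ℝ)..y, u⁻¹ * sawtoothSum a u| ≤ C := by
  obtain ⟨K, hK0, hK⟩ := powSum_le_of_one_lt (s := 1 - a) (by linarith)
  refine ⟨2 * K, fun y hy => ?_⟩
  rw [(intervalIntegrable_inv_mul_sawtoothSum a hy).2]
  have hd : ∀ d ∈ Finset.Icc 1 ⌊√y⌋₊, (0 : ℝ) < d ∧ (d : ℝ) ^ 2 ≤ y := fun d hd => by
    rw [Finset.mem_Icc, Nat.le_floor_iff (Real.sqrt_nonneg y), Real.le_sqrt (Nat.cast_nonneg d)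
      (zero_le_one.trans hy)] at hd
    exact ⟨by exact_mod_cast hd.1, hd.2⟩
  have hs : ∀ g : ℕ → ℝ, (∀ d ∈ Finset.Icc 1 ⌊√y⌋₊, |g d| ≤ (d : ℝ) ^ (-(1 - a))) →
      |∑ d ∈ Finset.Icc 1 ⌊√y⌋₊, g d| ≤ K := fun g hg =>
    (Finset.abs_sum_le_sum_abs _ _).trans ((Finset.sum_le_sum hg).trans (hK _))
  have h1 := hs (fun d => ∫ u in ((d : ℝ) ^ 2)..y, u⁻¹ * (d : ℝ) ^ a * sawtooth (u / d)) ?_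
  have h2 := hs (fun d => ∫ u in ((d : ℝ) ^ 2)..y, u⁻¹ * (u / d) ^ a * sawtooth (u / d)) ?_
  · refine (abs_add_le _ _).trans ?_
    linarith
  · intro d hd'
    obtain ⟨hd0, hdy⟩ := hd d hd'
    have e : ∫ u in ((d : ℝ) ^ 2)..y, u⁻¹ * (u / d) ^ a * sawtooth (u / d) =
        (d : ℝ)⁻¹ * ∫ u in ((d : ℝ) ^ 2)..y, (u / d) ^ (-(1 - a)) * sawtooth (u / d) := by
      rw [← intervalIntegral.integral_const_mul]
      refine intervalIntegral.integral_congr fun u hu => ?_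
      rw [uIcc_of_le hdy] at hu
      have hu0 : 0 < u := (by positivity : (0 : ℝ) < (d : ℝ) ^ 2).trans_le hu.1
      simp only [show -(1 - a) = a - 1 by ring]
      rw [Real.rpow_sub_one (div_pos hu0 hd0).ne']
      field_simp
    rw [e, abs_mul, abs_of_pos (inv_pos.mpr hd0)]
    calc _ ≤ (d : ℝ)⁻¹ * (d * (d : ℝ) ^ (-(1 - a))) := by
          gcongr
          exact abs_integral_sawtooth_div_le hd0 hdy (by linarith)
      _ = _ := by field_simp
  · intro d hd'
    obtain ⟨hd0, hdy⟩ := hd d hd'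
    have e : ∫ u in ((d : ℝ) ^ 2)..y, u⁻¹ * (d : ℝ) ^ a * sawtooth (u / d) =
        (d : ℝ) ^ a * (d : ℝ)⁻¹ *
          ∫ u in ((d : ℝ) ^ 2)..y, (u / d) ^ (-(1 : ℝ)) * sawtooth (u / d) := by
      rw [← intervalIntegral.integral_const_mul]
      refine intervalIntegral.integral_congr fun u hu => ?_
      rw [uIcc_of_le hdy] at hu
      have hu0 : 0 < u := (by positivity : (0 : ℝ) < (d : ℝ) ^ 2).trans_le hu.1
      simp only [Real.rpow_neg_one]
      field_simp
    rw [e, abs_mul, abs_of_pos (by positivity)]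
    calc _ ≤ (d : ℝ) ^ a * (d : ℝ)⁻¹ * (d * (d : ℝ) ^ (-(1 : ℝ))) := by
          gcongr
          exact abs_integral_sawtooth_div_le hd0 hdy one_pos
      _ = _ := by
          rw [show -(1 - a) = a - 1 by ring, Real.rpow_sub_one hd0.ne', Real.rpow_neg_one]
          field_simp

lemma dsum_log_eq_integral (c : ArithmeticFunction ℝ) {y : ℝ} (hy : 1 ≤ y) :
    dsum c Real.log y = ∫ u in (1 : ℝ)..y, u⁻¹ * ∑ k ∈ Finset.Icc 1 ⌊u⌋₊, c k := by
  have h := sum_Icc_one_mul_eq_sub_integral c (f := Real.log) (f' := fun u => u⁻¹) hy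
    (fun t ht => Real.hasDerivAt_log (one_pos.trans_le ht.1).ne')
    (continuousOn_id.inv₀ fun u hu => (one_pos.trans_le hu.1).ne')
  have e : dsum c Real.log y = Real.log y * ∑ k ∈ Finset.Icc 1 ⌊y⌋₊, c k -
      ∑ k ∈ Finset.Icc 1 ⌊y⌋₊, Real.log k * c k := by
    rw [dsum, Finset.mul_sum, ← Finset.sum_sub_distrib]
    refine Finset.sum_congr rfl fun k hk => ?_
    have hk0 : (k : ℝ) ≠ 0 := by
      have := (Finset.mem_Icc.mp hk).1
      exact_mod_cast (by lia : k ≠ 0)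
    rw [Real.log_div (by linarith) hk0]
    ring
  rw [e, h]
  ring

theorem abs_dsum_sigmaR_log_sub_le {a : ℝ} (ha : -1 < a) (ha' : a < 0) :
    ∃ C, ∀ y, 1 ≤ y → |dsum (sigmaR a) Real.log y - (zetaR (1 - a) * y +
      zetaR (1 + a) / (1 + a) ^ 2 * y ^ (1 + a) - zetaR (-a) / 2 * Real.log y)| ≤ C := by
  obtain ⟨C₁, h₁⟩ := abs_Delta_add_sawtoothSum_le ha ha'
  obtain ⟨C₂, h₂⟩ := abs_integral_sawtoothSum_le ha'
  have hC₁ : 0 ≤ C₁ := by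
    have := (abs_nonneg _).trans (h₁ 1 le_rfl)
    simpa using this
  -- The summands bound the main terms at the endpoint `u = 1`, the oscillating integral, and `C₁
  -- ∫_1^∞ u^(a/2-1) du`.
  refine ⟨|zetaR (1 - a) + zetaR (1 + a) / (1 + a) ^ 2| + C₂ + C₁ * (2 / -a), fun y hy => ?_⟩
  have h1a : 1 + a ≠ 0 := by linarith
  have hinv : ContinuousOn (fun u : ℝ => u⁻¹) (uIcc 1 y) := by
    rw [uIcc_of_le hy]
    exact continuousOn_id.inv₀ fun u hu => (one_pos.trans_le hu.1).ne'
  have hSint : IntervalIntegrable (fun u => u⁻¹ * ∑ k ∈ Finset.Icc 1 ⌊u⌋₊, sigmaR a k)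
      volume 1 y := by
    rw [intervalIntegrable_iff_integrableOn_Icc_of_le hy]
    rw [uIcc_of_le hy] at hinv
    exact integrableOn_mul_sum_Icc _ zero_le_one hinv.integrableOn_Icc
  have iinv : IntervalIntegrable (fun u : ℝ => u⁻¹) volume 1 y := hinv.intervalIntegrable
  have ia := intervalIntegrable_rpow_of_pos a one_pos hy
  have hmain : IntervalIntegrable (fun u => zetaR (1 - a) + zetaR (1 + a) / (1 + a) * u ^ a -
      zetaR (-a) / 2 * u⁻¹) volume 1 y :=
    (intervalIntegrable_const.add (ia.const_mul _)).sub (iinv.const_mul _)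
  have hmainI : ∫ u in (1 : ℝ)..y, (zetaR (1 - a) + zetaR (1 + a) / (1 + a) * u ^ a -
      zetaR (-a) / 2 * u⁻¹) = zetaR (1 - a) * (y - 1) +
      zetaR (1 + a) / (1 + a) ^ 2 * (y ^ (1 + a) - 1) - zetaR (-a) / 2 * Real.log y := by
    rw [intervalIntegral.integral_sub (intervalIntegrable_const.add (ia.const_mul _))
      (iinv.const_mul _), intervalIntegral.integral_add intervalIntegrable_const (ia.const_mul _),
      intervalIntegral.integral_const_mul, intervalIntegral.integral_const_mul,
      integral_rpow_of_pos (by linarith) one_pos hy, integral_inv_of_pos one_pos (by linarith),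
      intervalIntegral.integral_const, div_one, Real.one_rpow, add_comm a 1]
    simp only [smul_eq_mul]
    field_simp
  obtain ⟨hsaw, -⟩ := intervalIntegrable_inv_mul_sawtoothSum a hy
  have herr : |∫ u in (1 : ℝ)..y, (u⁻¹ * (∑ k ∈ Finset.Icc 1 ⌊u⌋₊, sigmaR a k) -
      (zetaR (1 - a) + zetaR (1 + a) / (1 + a) * u ^ a - zetaR (-a) / 2 * u⁻¹) +
      u⁻¹ * sawtoothSum a u)| ≤ ∫ u in (1 : ℝ)..y, C₁ * u ^ (a / 2 - 1) := by
    rw [← Real.norm_eq_abs]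
    refine intervalIntegral.norm_integral_le_of_norm_le hy (ae_of_all _ fun u hu => ?_)
      ((intervalIntegrable_rpow_of_pos _ one_pos hy).const_mul _)
    have hu0 : 0 < u := one_pos.trans hu.1
    have e : u⁻¹ * (∑ k ∈ Finset.Icc 1 ⌊u⌋₊, sigmaR a k) -
      (zetaR (1 - a) + zetaR (1 + a) / (1 + a) * u ^ a - zetaR (-a) / 2 * u⁻¹) +
      u⁻¹ * sawtoothSum a u = u⁻¹ * (Delta a u + sawtoothSum a u) := by
      rw [Delta, Real.rpow_add hu0, Real.rpow_one]
      field_simp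
    rw [e, Real.norm_eq_abs, abs_mul, abs_of_pos (inv_pos.mpr hu0), Real.rpow_sub_one hu0.ne']
    calc u⁻¹ * |Delta a u + sawtoothSum a u| ≤ u⁻¹ * (C₁ * u ^ (a / 2)) := by
          gcongr; exact h₁ u hu.1.le
      _ = _ := by ring
  have hbound : ∫ u in (1 : ℝ)..y, C₁ * u ^ (a / 2 - 1) ≤ C₁ * (2 / -a) := by
    rw [intervalIntegral.integral_const_mul, integral_rpow_of_pos (by linarith) one_pos hy,
      sub_add_cancel, Real.one_rpow]
    refine mul_le_mul_of_nonneg_left ?_ hC₁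
    have : 0 ≤ y ^ (a / 2) := by positivity
    have hna : 0 < -a := by linarith
    rw [show (y ^ (a / 2) - 1) / (a / 2) = (1 - y ^ (a / 2)) * 2 / -a by field_simp; ring]
    gcongr
    linarith
  rw [intervalIntegral.integral_add (hSint.sub hmain) hsaw,
    intervalIntegral.integral_sub hSint hmain, hmainI, ← dsum_log_eq_integral _ hy] at herr
  have h3 := h₂ y hy
  have h4 := le_abs_self (zetaR (1 - a) + zetaR (1 + a) / (1 + a) ^ 2)
  have h5 := neg_abs_le (zetaR (1 - a) + zetaR (1 + a) / (1 + a) ^ 2)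
  have herr' := herr.trans hbound
  rw [abs_le] at herr' h3 ⊢
  constructor <;> linarith

/-! ### Functions bounded by powers of the logarithm -/

/-- `f(x) = O((1 + log x) ^ k)` uniformly for `x ≥ 1`. -/
def LogBdd (k : ℕ) (f : ℝ → ℝ) : Prop :=
  ∃ C, 0 ≤ C ∧ ∀ x, 1 ≤ x → |f x| ≤ C * (1 + Real.log x) ^ k

lemma LogBdd.of_bound {f : ℝ → ℝ} {C : ℝ} (h : ∀ x, 1 ≤ x → |f x| ≤ C) : LogBdd 0 f :=
  ⟨C, (abs_nonneg _).trans (h 1 le_rfl), fun x hx => by simpa using h x hx⟩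

lemma LogBdd.congr {k : ℕ} {f g : ℝ → ℝ} (hf : LogBdd k f) (h : ∀ x, 1 ≤ x → f x = g x) :
    LogBdd k g := by
  obtain ⟨C, hC, hb⟩ := hf
  exact ⟨C, hC, fun x hx => by rw [← h x hx]; exact hb x hx⟩

lemma LogBdd.mono {k l : ℕ} {f : ℝ → ℝ} (hf : LogBdd k f) (hkl : k ≤ l) : LogBdd l f := by
  obtain ⟨C, hC, hb⟩ := hf
  refine ⟨C, hC, fun x hx => (hb x hx).trans ?_⟩
  gcongr
  linarith [Real.log_nonneg hx]

lemma LogBdd.add {k : ℕ} {f g : ℝ → ℝ} (hf : LogBdd k f) (hg : LogBdd k g) :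
    LogBdd k (fun x => f x + g x) := by
  obtain ⟨C, hC, hb⟩ := hf
  obtain ⟨D, hD, hd⟩ := hg
  refine ⟨C + D, add_nonneg hC hD, fun x hx => (abs_add_le _ _).trans ?_⟩
  rw [add_mul]
  exact add_le_add (hb x hx) (hd x hx)

lemma LogBdd.const_mul {k : ℕ} {f : ℝ → ℝ} (hf : LogBdd k f) (r : ℝ) :
    LogBdd k (fun x => r * f x) := by
  obtain ⟨C, hC, hb⟩ := hf
  refine ⟨|r| * C, by positivity, fun x hx => ?_⟩
  rw [abs_mul, mul_assoc]
  exact mul_le_mul_of_nonneg_left (hb x hx) (abs_nonneg r)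

lemma LogBdd.sub {k : ℕ} {f g : ℝ → ℝ} (hf : LogBdd k f) (hg : LogBdd k g) :
    LogBdd k (fun x => f x - g x) :=
  (hf.add (hg.const_mul (-1))).congr fun x _ => by ring

lemma LogBdd.log_sub_one_mul {k : ℕ} {f : ℝ → ℝ} (hf : LogBdd k f) :
    LogBdd (k + 1) (fun x => (Real.log x - 1) * f x) := by
  obtain ⟨C, hC, hb⟩ := hf
  refine ⟨C, hC, fun x hx => ?_⟩
  have hl := Real.log_nonneg hx
  rw [abs_mul, pow_succ, ← mul_assoc, mul_comm]
  refine mul_le_mul (hb x hx) ?_ (abs_nonneg _) (by positivity)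
  rw [abs_le]; constructor <;> linarith

lemma LogBdd.isBigO {k : ℕ} {f : ℝ → ℝ} (hf : LogBdd k f) :
    f =O[atTop] fun x => Real.log x ^ k := by
  obtain ⟨C, hC, hb⟩ := hf
  refine IsBigO.of_bound (C * 2 ^ k) ?_
  filter_upwards [eventually_ge_atTop (Real.exp 1)] with x hx
  have hx1 : 1 ≤ x := le_trans (by simp) hx
  have hl : 1 ≤ Real.log x := (Real.le_log_iff_exp_le (by linarith)).mpr hx
  rw [Real.norm_eq_abs, Real.norm_eq_abs, abs_of_nonneg (by positivity : 0 ≤ Real.log x ^ k),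
    mul_assoc, ← mul_pow]
  refine (hb x hx1).trans ?_
  gcongr
  linarith

/-! ### Dirichlet series at real arguments and their tails -/

lemma hasSum_re_of_LSeriesHasSum {f : ℕ → ℂ} {g : ℕ → ℝ} (hfg : ∀ n, n ≠ 0 → f n = g n) {s : ℝ}
    (hs : s ≠ 0) {Z : ℂ} (h : LSeriesHasSum f s Z) :
    HasSum (fun n : ℕ => g n * (n : ℝ) ^ (-s)) Z.re := by
  have h2 := Complex.hasSum_re h
  suffices e : (fun n : ℕ => g n * (n : ℝ) ^ (-s)) = fun n => (LSeries.term f s n).re by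
    rw [e]; exact h2
  ext n
  rcases eq_or_ne n 0 with rfl | hn
  · simp [Real.zero_rpow (neg_ne_zero.mpr hs)]
  · have e : LSeries.term f s n = ((g n * (n : ℝ) ^ (-s) : ℝ) : ℂ) := by
      rw [LSeries.term_of_ne_zero hn, hfg n hn, Real.rpow_neg (Nat.cast_nonneg n),
        Complex.ofReal_mul, Complex.ofReal_inv, Complex.ofReal_cpow (Nat.cast_nonneg n), div_eq_mul_inv]
      simp
    rw [e, Complex.ofReal_re]

lemma hasSum_zetaR {s : ℝ} (hs : 1 < s) : HasSum (fun n : ℕ => (n : ℝ) ^ (-s)) (zetaR s) := by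
  have h := hasSum_re_of_LSeriesHasSum (g := fun _ => 1) (s := s) (fun n _ => by simp)
    (by linarith) (LSeriesHasSum_one (s := s) (by simpa using hs))
  simp only [one_mul] at h
  exact h

lemma zetaR_pos {s : ℝ} (hs : 1 < s) : 0 < zetaR s := riemannZeta_re_pos_of_one_lt hs

lemma ofReal_zetaR {s : ℝ} (hs : 1 < s) : (zetaR s : ℂ) = riemannZeta s :=
  Complex.ext rfl (by simpa using (riemannZeta_im_eq_zero_of_one_lt hs).symm)

/-- The tail of a series is at most the tail of a majorant; the majorant is needed only off `F`,
which the von Mangoldt estimate exploits. -/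
lemma abs_sub_sum_le_of_hasSum {c b : ℕ → ℝ} {Z B : ℝ} (hc : HasSum c Z) (hb : HasSum b B)
    (F : Finset ℕ) (h : ∀ n, n ∉ F → |c n| ≤ b n) :
    |∑ n ∈ F, c n - Z| ≤ B - ∑ n ∈ F, b n := by
  have h1 : Tendsto (fun G : Finset ℕ => |∑ n ∈ F, c n - ∑ n ∈ G, c n|) atTop
      (𝓝 |∑ n ∈ F, c n - Z|) := (tendsto_const_nhds.sub hc).abs
  have h2 : Tendsto (fun G : Finset ℕ => ∑ n ∈ G, b n - ∑ n ∈ F, b n) atTop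
      (𝓝 (B - ∑ n ∈ F, b n)) := hb.sub_const _
  refine le_of_tendsto_of_tendsto h1 h2 ?_
  filter_upwards [eventually_ge_atTop F] with G hG
  rw [← Finset.sum_sdiff hG, ← Finset.sum_sdiff hG (f := b)]
  simp only [sub_add_cancel_right, add_sub_cancel_right, abs_neg]
  exact (Finset.abs_sum_le_sum_abs _ _).trans
    (Finset.sum_le_sum fun n hn => h n (Finset.mem_sdiff.mp hn).2)

lemma zetaR_sub_powSum_le {s : ℝ} (hs : 1 < s) :
    ∃ C, 0 ≤ C ∧ ∀ t, 1 ≤ t → zetaR s - powSum s t ≤ C * t ^ (1 - s) := by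
  have hs1 : 0 < s - 1 := by linarith
  refine ⟨1 / (s - 1) + 1 / 2 + s, by positivity, fun t ht => ?_⟩
  have ht0 : 0 < t := one_pos.trans_le ht
  have h := abs_powSum_sub_le (by linarith : 0 < s) hs.ne' ht
  have h1 : |sawtooth t * t ^ (-s)| ≤ 1 / 2 * t ^ (1 - s) := by
    rw [abs_mul, abs_of_pos (Real.rpow_pos_of_pos ht0 _)]
    exact mul_le_mul (abs_sawtooth_le t)
      (Real.rpow_le_rpow_of_exponent_le ht (by linarith)) (by positivity) (by norm_num)
  have h2 : s * t ^ (-s - 1) ≤ s * t ^ (1 - s) :=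
    mul_le_mul_of_nonneg_left (Real.rpow_le_rpow_of_exponent_le ht (by linarith)) (by linarith)
  have h3 : t ^ (1 - s) / (1 - s) = -(1 / (s - 1) * t ^ (1 - s)) := by
    rw [← neg_sub s 1]; field_simp
  rw [h3] at h
  rw [abs_le] at h h1
  linarith

lemma hasSum_moebius {s : ℝ} (hs : 1 < s) :
    HasSum (fun n : ℕ => moebiusR n * (n : ℝ) ^ (-s)) (1 / zetaR s) := by
  have hs' : 1 < (s : ℂ).re := by simpa using hs
  have h := hasSum_re_of_LSeriesHasSum (g := moebiusR) (s := s) (fun n _ => by simp [moebiusR])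
    (by linarith) (ArithmeticFunction.LSeriesSummable_moebius_iff.mpr hs').LSeriesHasSum
  have e : LSeries (fun n => ((ArithmeticFunction.moebius n : ℤ) : ℂ)) s =
      ((1 / zetaR s : ℝ) : ℂ) := by
    have := LSeries_one_mul_Lseries_moebius hs'
    rw [LSeries_one_eq_riemannZeta hs', ← ofReal_zetaR hs] at this
    rw [Complex.ofReal_div, Complex.ofReal_one]
    exact eq_one_div_of_mul_eq_one_right this
  rwa [e, Complex.ofReal_re] at h

lemma hasSum_vonMangoldt {s : ℝ} (hs : 1 < s) :
    HasSum (fun n : ℕ => ArithmeticFunction.vonMangoldt n * (n : ℝ) ^ (-s))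
      (-zetaR' s / zetaR s) := by
  have hs' : 1 < (s : ℂ).re := by simpa using hs
  have h := hasSum_re_of_LSeriesHasSum (g := ArithmeticFunction.vonMangoldt) (s := s)
    (fun n _ => rfl) (by linarith)
    (ArithmeticFunction.LSeriesSummable_vonMangoldt hs').LSeriesHasSum
  rwa [ArithmeticFunction.LSeries_vonMangoldt_eq_deriv_riemannZeta_div hs', ← ofReal_zetaR hs,
    Complex.div_ofReal_re, Complex.neg_re] at h

/-! ### The Möbius twist -/

/-- The arithmetical function `n ↦ c(n) / n`. -/
def divId (c : ArithmeticFunction ℝ) : ArithmeticFunction ℝ := ⟨fun n => c n / n, by simp⟩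

lemma divId_apply (c : ArithmeticFunction ℝ) (n : ℕ) : divId c n = c n / n := rfl

lemma divId_mul (c d : ArithmeticFunction ℝ) : divId (c * d) = divId c * divId d := by
  ext n
  rw [divId_apply, ArithmeticFunction.mul_apply, ArithmeticFunction.mul_apply, Finset.sum_div]
  refine Finset.sum_congr rfl fun p hp => ?_
  rw [← (Nat.mem_divisorsAntidiagonal.mp hp).1, divId_apply, divId_apply, Nat.cast_mul,
    mul_div_mul_comm]

lemma divId_one : divId 1 = 1 := by
  ext n
  by_cases hn : n = 1
  · simp [divId_apply, hn]
  · simp [divId_apply, ArithmeticFunction.one_apply_ne hn]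

lemma abs_moebiusR_le (n : ℕ) : |moebiusR n| ≤ 1 := by
  have := ArithmeticFunction.abs_moebius_le_one (n := n)
  rw [moebiusR, ArithmeticFunction.intCoe_apply]
  exact_mod_cast this

lemma one_le_div_of_mem_Icc_floor {x : ℝ} {k : ℕ} (hk : k ∈ Finset.Icc 1 ⌊x⌋₊) :
    (0 : ℝ) < k ∧ 1 ≤ x / k ∧ x / k ≤ x := by
  rw [Finset.mem_Icc] at hk
  have hx : (k : ℝ) ≤ x := (Nat.le_floor_iff' (by lia)).mp hk.2
  have h1 : (1 : ℝ) ≤ k := by exact_mod_cast hk.1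
  have h0 : (0 : ℝ) < k := by linarith
  exact ⟨h0, by rwa [le_div_iff₀ h0, one_mul], div_le_self (by linarith) h1⟩

lemma sum_inv_le {x : ℝ} (hx : 1 ≤ x) :
    ∑ k ∈ Finset.Icc 1 ⌊x⌋₊, (1 : ℝ) / k ≤ 1 + Real.log x := by
  have h := harmonic_floor_le_one_add_log x hx
  rw [harmonic_eq_sum_Icc] at h
  push_cast at h
  simpa using h

/-- Trivial estimate with `|μ| ≤ 1`: the harmonic sum costs one logarithm. -/
lemma LogBdd.dsum_moebius {k : ℕ} {W : ℝ → ℝ} (hW : LogBdd k W) :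
    LogBdd (k + 1) (dsum (divId moebiusR) W) := by
  obtain ⟨C, hC, hb⟩ := hW
  refine ⟨C, hC, fun x hx => ?_⟩
  have hl := Real.log_nonneg hx
  calc |dsum (divId moebiusR) W x| ≤
        ∑ j ∈ Finset.Icc 1 ⌊x⌋₊, |divId moebiusR j * W (x / j)| := Finset.abs_sum_le_sum_abs _ _
    _ ≤ ∑ j ∈ Finset.Icc 1 ⌊x⌋₊, 1 / (j : ℝ) * (C * (1 + Real.log x) ^ k) := by
        refine Finset.sum_le_sum fun j hj => ?_
        obtain ⟨hj0, hj1, hj2⟩ := one_le_div_of_mem_Icc_floor hj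
        rw [abs_mul, divId_apply, abs_div, abs_of_pos hj0]
        have hl' := Real.log_nonneg hj1
        refine mul_le_mul ?_ ((hb _ hj1).trans ?_) (abs_nonneg _) (by positivity)
        · gcongr; exact abs_moebiusR_le j
        · gcongr
    _ = (∑ j ∈ Finset.Icc 1 ⌊x⌋₊, 1 / (j : ℝ)) * (C * (1 + Real.log x) ^ k) := by
        rw [Finset.sum_mul]
    _ ≤ (1 + Real.log x) * (C * (1 + Real.log x) ^ k) := by
        gcongr; exact sum_inv_le hx
    _ = C * (1 + Real.log x) ^ (k + 1) := by ring

lemma dsum_zeta_one {y : ℝ} (hy : 0 ≤ y) :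
    dsum ((ArithmeticFunction.zeta : ArithmeticFunction ℕ) : ArithmeticFunction ℝ)
      (fun _ => 1) y = y - Int.fract y := by
  rw [dsum_one_one, ← sum_Icc_floor_one hy]
  refine Finset.sum_congr rfl fun k hk => ?_
  have : k ≠ 0 := by have := (Finset.mem_Icc.mp hk).1; lia
  simp [this]

lemma moebiusR_mul_zeta : moebiusR *
    ((ArithmeticFunction.zeta : ArithmeticFunction ℕ) : ArithmeticFunction ℝ) = 1 := by
  rw [moebiusR]
  exact ArithmeticFunction.coe_moebius_mul_coe_zeta

lemma dsum_one (W : ℝ → ℝ) {x : ℝ} (hx : 1 ≤ x) : dsum 1 W x = W x := by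
  rw [dsum, Finset.sum_eq_single 1]
  · simp
  · intro k _ hk
    rw [ArithmeticFunction.one_apply_ne hk, zero_mul]
  · intro h
    exact absurd (Finset.mem_Icc.mpr ⟨le_rfl, (Nat.one_le_floor_iff _).mpr hx⟩) h

/-- From `∑_{k ≤ x} μ(k) ⌊x/k⌋ = 1`: dropping the fractional parts costs at most `x`, so `x |∑
μ(k)/k| ≤ 1 + x ≤ 2x`. -/
lemma abs_sum_moebius_div_le {x : ℝ} (hx : 1 ≤ x) :
    |∑ k ∈ Finset.Icc 1 ⌊x⌋₊, divId moebiusR k| ≤ 2 := by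
  have hx0 : 0 < x := one_pos.trans_le hx
  have h1 : dsum moebiusR (fun y => y - Int.fract y) x = 1 := by
    rw [← dsum_congr moebiusR (fun y hy => dsum_zeta_one (zero_le_one.trans hy)), ← dsum_mul,
      moebiusR_mul_zeta, dsum_one _ hx]
  have h2 : dsum moebiusR (fun y => y) x = x * ∑ k ∈ Finset.Icc 1 ⌊x⌋₊, divId moebiusR k := by
    rw [dsum, Finset.mul_sum]
    exact Finset.sum_congr rfl fun k _ => by rw [divId_apply]; ring
  have h3 : |dsum moebiusR Int.fract x| ≤ x := by
    calc |dsum moebiusR Int.fract x| ≤ ∑ k ∈ Finset.Icc 1 ⌊x⌋₊, |moebiusR k * Int.fract (x / k)| :=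
          Finset.abs_sum_le_sum_abs _ _
      _ ≤ ∑ _k ∈ Finset.Icc 1 ⌊x⌋₊, (1 : ℝ) := by
          refine Finset.sum_le_sum fun k _ => ?_
          rw [abs_mul, abs_of_nonneg (Int.fract_nonneg (x / (k : ℝ)))]
          exact mul_le_one₀ (abs_moebiusR_le k) (Int.fract_nonneg _) (Int.fract_lt_one _).le
      _ ≤ x := by
          rw [sum_Icc_floor_one hx0.le]
          linarith [Int.fract_nonneg x]
  rw [dsum_sub, h2] at h1
  have h4 : |x * ∑ k ∈ Finset.Icc 1 ⌊x⌋₊, divId moebiusR k| ≤ x * 2 := by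
    rw [abs_le] at h3 ⊢
    constructor <;> linarith
  rw [abs_mul, abs_of_pos hx0] at h4
  exact le_of_mul_le_mul_left h4 hx0

lemma logBdd_dsum_moebius_one : LogBdd 0 (dsum (divId moebiusR) (fun _ => 1)) :=
  LogBdd.of_bound fun x hx => by
    rw [dsum_one_one]
    exact abs_sum_moebius_div_le hx

/-- Partial summation from the boundedness of `∑ μ(k)/k`; the trivial estimate would give the square
of the logarithm. -/
lemma logBdd_dsum_moebius_log : LogBdd 1 (dsum (divId moebiusR) Real.log) := by
  refine ⟨2, two_pos.le, fun x hx => ?_⟩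
  rw [dsum_log_eq_integral _ hx, pow_one]
  have h : ‖∫ u in (1 : ℝ)..x, u⁻¹ * ∑ k ∈ Finset.Icc 1 ⌊u⌋₊, divId moebiusR k‖ ≤
      ∫ u in (1 : ℝ)..x, u⁻¹ * 2 := by
    refine intervalIntegral.norm_integral_le_of_norm_le hx (ae_of_all _ fun u hu => ?_) ?_
    · have hu0 : 0 < u := one_pos.trans hu.1
      rw [Real.norm_eq_abs, abs_mul, abs_of_pos (inv_pos.mpr hu0)]
      gcongr
      exact abs_sum_moebius_div_le hu.1.le
    · refine ((continuousOn_id.inv₀ fun u hu => ?_).mul continuousOn_const).intervalIntegrable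
      rw [uIcc_of_le hx] at hu
      exact (one_pos.trans_le hu.1).ne'
  rw [intervalIntegral.integral_mul_const, integral_inv_of_pos one_pos (by linarith), div_one] at h
  rw [← Real.norm_eq_abs]
  linarith

/-- The twist is `x^s` times a partial sum of `∑ μ(n) n^(-1-s) = 1/ζ(1+s)`, whose tail is
`O(x^(-s))`. -/
lemma logBdd_dsum_moebius_rpow {s : ℝ} (hs : 0 < s) :
    LogBdd 0 (fun x => dsum (divId moebiusR) (fun y => y ^ s) x - x ^ s / zetaR (1 + s)) := by
  obtain ⟨C, hC, hb⟩ := zetaR_sub_powSum_le (s := 1 + s) (by linarith)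
  refine LogBdd.of_bound (C := C) fun x hx => ?_
  have hx0 : 0 < x := one_pos.trans_le hx
  have h := abs_sub_sum_le_of_hasSum (hasSum_moebius (s := 1 + s) (by linarith))
    (hasSum_zetaR (s := 1 + s) (by linarith)) (Finset.Icc 1 ⌊x⌋₊) (fun n _ => by
      rw [abs_mul, abs_of_nonneg (by positivity : (0 : ℝ) ≤ (n : ℝ) ^ (-(1 + s)))]
      exact mul_le_of_le_one_left (by positivity) (abs_moebiusR_le n))
  have e : dsum (divId moebiusR) (fun y => y ^ s) x =
      x ^ s * ∑ n ∈ Finset.Icc 1 ⌊x⌋₊, moebiusR n * (n : ℝ) ^ (-(1 + s)) := by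
    rw [dsum, Finset.mul_sum]
    refine Finset.sum_congr rfl fun k hk => ?_
    have hk0 := (one_le_div_of_mem_Icc_floor hk).1
    rw [divId_apply, Real.div_rpow hx0.le hk0.le, Real.rpow_neg hk0.le, Real.rpow_add hk0,
      Real.rpow_one]
    field_simp
  have e2 : x ^ s * ∑ n ∈ Finset.Icc 1 ⌊x⌋₊, moebiusR n * (n : ℝ) ^ (-(1 + s)) -
      x ^ s / zetaR (1 + s) = x ^ s *
      (∑ n ∈ Finset.Icc 1 ⌊x⌋₊, moebiusR n * (n : ℝ) ^ (-(1 + s)) - 1 / zetaR (1 + s)) := by ring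
  rw [e, e2, abs_mul, abs_of_pos (Real.rpow_pos_of_pos hx0 s)]
  have hb' := hb x hx
  rw [powSum] at hb'
  calc _ ≤ x ^ s * (C * x ^ (1 - (1 + s))) := by
        gcongr
        exact h.trans hb'
    _ = C * (x ^ s * x ^ (1 - (1 + s))) := by ring
    _ = C := by rw [← Real.rpow_add hx0]; simp

lemma logBdd_dsum_moebius_id :
    LogBdd 0 (fun x => dsum (divId moebiusR) (fun y => y) x - x / zetaR 2) := by
  refine (logBdd_dsum_moebius_rpow one_pos).congr fun x _ => ?_
  simp only [Real.rpow_one]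
  norm_num

/-- The Möbius twist of an asymptotic expansion. -/
lemma LogBdd.dsum_moebius_expansion {k : ℕ} {s α β : ℝ} (hs : 0 < s) {V D : ℝ → ℝ}
    (h : LogBdd k (fun y => V y - (α * y + β * y ^ s + D y))) :
    LogBdd (k + 1) (fun x => dsum (divId moebiusR) V x -
      (α / zetaR 2 * x + β / zetaR (1 + s) * x ^ s + dsum (divId moebiusR) D x)) := by
  have h1 := h.dsum_moebius
  have h2 := ((logBdd_dsum_moebius_id.const_mul α).add
    ((logBdd_dsum_moebius_rpow hs).const_mul β)).mono (Nat.zero_le (k + 1))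
  refine (h1.add h2).congr fun x _ => ?_
  rw [dsum_sub, dsum_add, dsum_add, dsum_const_mul, dsum_const_mul]
  ring

/-! ### Convolutions with `id_a` -/

lemma logBdd_powSum_sub {a : ℝ} (ha : -1 < a) (ha' : a < 0) :
    LogBdd 0 (fun y => dsum (idPow a) (fun _ => 1) y - y ^ (1 + a) / (1 + a)) := by
  refine LogBdd.of_bound (C := |zetaR (-a)| + 2) fun y hy => ?_
  have h := abs_powSum_sub_le (s := -a) (by linarith) (by linarith) hy
  rw [neg_neg, sub_neg_eq_add, powSum_eq_sum_idPow] at h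
  have hya : y ^ a ≤ 1 := Real.rpow_le_one_of_one_le_of_nonpos hy ha'.le
  have hya0 : 0 ≤ y ^ a := by positivity
  have h1 : |sawtooth y * y ^ a| ≤ 1 / 2 := by
    rw [abs_mul, abs_of_nonneg hya0]
    nlinarith [abs_sawtooth_le y, abs_nonneg (sawtooth y)]
  have h2 : -a * y ^ (a - 1) ≤ 1 := by
    have : y ^ (a - 1) ≤ 1 := Real.rpow_le_one_of_one_le_of_nonpos hy (by linarith)
    have : 0 ≤ y ^ (a - 1) := by positivity
    nlinarith
  have h3 := le_abs_self (zetaR (-a))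
  have h4 := neg_abs_le (zetaR (-a))
  rw [abs_le] at h h1 ⊢
  constructor <;> linarith

/-- Inserting `∑_{m ≤ y} m^a = y^(1+a)/(1+a) + O(1)` costs `O(∑ |c n|)`, controlled by `hc`;
completing the series to its value `Z` costs what `hZ` controls. -/
lemma logBdd_dsum_dsum_idPow {a : ℝ} (ha : -1 < a) (ha' : a < 0) {k : ℕ}
    (c : ArithmeticFunction ℝ) (Z : ℝ)
    (hc : LogBdd k (fun x => ∑ n ∈ Finset.Icc 1 ⌊x⌋₊, |c n|))
    (hZ : LogBdd k (fun x => x ^ (1 + a) *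
      (∑ n ∈ Finset.Icc 1 ⌊x⌋₊, c n * (n : ℝ) ^ (-(1 + a)) - Z))) :
    LogBdd k (fun x => dsum c (dsum (idPow a) (fun _ => 1)) x - Z / (1 + a) * x ^ (1 + a)) := by
  obtain ⟨C, hC, hb⟩ := logBdd_powSum_sub ha ha'
  have h1 : LogBdd k (dsum c (fun y => dsum (idPow a) (fun _ => 1) y - y ^ (1 + a) / (1 + a))) := by
    obtain ⟨D, hD, hd⟩ := hc
    refine ⟨C * D, by positivity, fun x hx => ?_⟩
    calc _ ≤ ∑ n ∈ Finset.Icc 1 ⌊x⌋₊, |c n * (dsum (idPow a) (fun _ => 1) (x / n) -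
          (x / n) ^ (1 + a) / (1 + a))| := Finset.abs_sum_le_sum_abs _ _
      _ ≤ ∑ n ∈ Finset.Icc 1 ⌊x⌋₊, C * |c n| := by
          refine Finset.sum_le_sum fun n hn => ?_
          rw [abs_mul, mul_comm]
          have := hb _ (one_le_div_of_mem_Icc_floor hn).2.1
          simp only [pow_zero, mul_one] at this
          gcongr
      _ = C * ∑ n ∈ Finset.Icc 1 ⌊x⌋₊, |c n| := by rw [Finset.mul_sum]
      _ ≤ C * (D * (1 + Real.log x) ^ k) := by
          gcongr
          exact (le_abs_self _).trans (hd x hx)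
      _ = _ := by ring
  refine (h1.add (hZ.const_mul (1 / (1 + a)))).congr fun x hx => ?_
  have hx0 : 0 < x := one_pos.trans_le hx
  have e : dsum c (fun y => y ^ (1 + a) / (1 + a)) x = 1 / (1 + a) * (x ^ (1 + a) *
      ∑ n ∈ Finset.Icc 1 ⌊x⌋₊, c n * (n : ℝ) ^ (-(1 + a))) := by
    rw [dsum, Finset.mul_sum, Finset.mul_sum]
    refine Finset.sum_congr rfl fun n hn => ?_
    have hn0 := (one_le_div_of_mem_Icc_floor hn).1
    rw [Real.div_rpow hx0.le hn0.le, Real.rpow_neg hn0.le]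
    ring
  rw [dsum_sub, e]
  ring

/-! ### The von Mangoldt function -/

/-- Chebyshev's argument: `∑ Λ(n) ⌊x/n⌋ = ∑_{n ≤ x} log n ≤ x log x`, and `⌊y⌋ ≥ y/2` for `y ≥ 1`.
-/
lemma sum_vonMangoldt_div_le {x : ℝ} (hx : 1 ≤ x) :
    ∑ n ∈ Finset.Icc 1 ⌊x⌋₊, ArithmeticFunction.vonMangoldt n / n ≤ 2 * Real.log x := by
  have hx0 : 0 < x := one_pos.trans_le hx
  have h1 : dsum ArithmeticFunction.vonMangoldt (fun y => y - Int.fract y) x =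
      ∑ n ∈ Finset.Icc 1 ⌊x⌋₊, Real.log n := by
    rw [← dsum_congr _ (fun y hy => dsum_zeta_one (zero_le_one.trans hy)), ← dsum_mul,
      ArithmeticFunction.vonMangoldt_mul_zeta, dsum_one_one]
    simp [ArithmeticFunction.log_apply]
  have h2 : ∑ n ∈ Finset.Icc 1 ⌊x⌋₊, Real.log n ≤ x * Real.log x := by
    calc ∑ n ∈ Finset.Icc 1 ⌊x⌋₊, Real.log n ≤ ∑ n ∈ Finset.Icc 1 ⌊x⌋₊, 1 * Real.log x := by
          refine Finset.sum_le_sum fun n hn => ?_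
          obtain ⟨hn0, hn1, -⟩ := one_le_div_of_mem_Icc_floor hn
          rw [one_mul]
          rw [le_div_iff₀ hn0, one_mul] at hn1
          exact Real.log_le_log hn0 hn1
      _ ≤ x * Real.log x := by
          rw [← Finset.sum_mul, sum_Icc_floor_one hx0.le]
          have := Real.log_nonneg hx
          gcongr
          linarith [Int.fract_nonneg x]
  have h3 : x / 2 * ∑ n ∈ Finset.Icc 1 ⌊x⌋₊, ArithmeticFunction.vonMangoldt n / n ≤
      dsum ArithmeticFunction.vonMangoldt (fun y => y - Int.fract y) x := by
    rw [dsum, Finset.mul_sum]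
    refine Finset.sum_le_sum fun n hn => ?_
    obtain ⟨hn0, hn1, -⟩ := one_le_div_of_mem_Icc_floor hn
    have hf : x / n / 2 ≤ x / n - Int.fract (x / n) := by
      have h1 : (1 : ℝ) ≤ ⌊x / n⌋ := by exact_mod_cast Int.le_floor.mpr (by exact_mod_cast hn1)
      have h2 := Int.fract_lt_one (x / n)
      have h3 := Int.self_sub_fract (x / (n : ℝ))
      linarith
    calc x / 2 * (ArithmeticFunction.vonMangoldt n / n) =
          ArithmeticFunction.vonMangoldt n * (x / n / 2) := by ring
      _ ≤ _ := mul_le_mul_of_nonneg_left hf ArithmeticFunction.vonMangoldt_nonneg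
  rw [h1] at h3
  have h4 := h3.trans h2
  have h5 : x / 2 * ∑ n ∈ Finset.Icc 1 ⌊x⌋₊, ArithmeticFunction.vonMangoldt n / n ≤
      x / 2 * (2 * Real.log x) := by linarith
  exact le_of_mul_le_mul_left h5 (by positivity)

lemma logBdd_vonMangoldt_tail {s : ℝ} (hs : 1 < s) :
    LogBdd 1 (fun x => x ^ (s - 1) * (∑ n ∈ Finset.Icc 1 ⌊x⌋₊,
      ArithmeticFunction.vonMangoldt n * (n : ℝ) ^ (-s) - -zetaR' s / zetaR s)) := by
  -- For `n > x` the majorant is `Λ(n) ≤ log x + log (n/x) ≤ log x + (n/x)^ε/ε`; this `ε` keeps `s -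
  -- ε > 1`.
  obtain ⟨ε, hε⟩ : ∃ ε, ε = (s - 1) / 2 := ⟨_, rfl⟩
  have hε0 : 0 < ε := by rw [hε]; linarith
  have hs' : 1 < s - ε := by rw [hε]; linarith
  obtain ⟨C, hC, hb⟩ := zetaR_sub_powSum_le hs
  obtain ⟨D, hD, hd⟩ := zetaR_sub_powSum_le hs'
  refine ⟨C + D / ε, by positivity, fun x hx => ?_⟩
  have hx0 : 0 < x := one_pos.trans_le hx
  have hl := Real.log_nonneg hx
  have h := abs_sub_sum_le_of_hasSum (hasSum_vonMangoldt hs)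
    (((hasSum_zetaR hs).mul_left (Real.log x)).add
      ((hasSum_zetaR hs').mul_left (x ^ (-ε) / ε))) (Finset.Icc 1 ⌊x⌋₊) (fun n hn => by
      rcases eq_or_ne n 0 with rfl | hn0
      · simp only [ArithmeticFunction.map_zero, zero_mul, abs_zero]
        positivity
      have hn1 : 1 ≤ n := Nat.one_le_iff_ne_zero.mpr hn0
      have hxn : x < n := by
        rw [Finset.mem_Icc, not_and, not_le] at hn
        exact (Nat.floor_lt hx0.le).mp (hn hn1)
      have hnpos : (0 : ℝ) < n := hx0.trans hxn
      rw [abs_of_nonneg (mul_nonneg ArithmeticFunction.vonMangoldt_nonneg (by positivity))]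
      have h1 : ArithmeticFunction.vonMangoldt n ≤ Real.log x + (n / x) ^ ε / ε := by
        refine ArithmeticFunction.vonMangoldt_le_log.trans ?_
        have := Real.log_le_rpow_div (div_nonneg hnpos.le hx0.le) hε0
        rw [Real.log_div hnpos.ne' hx0.ne'] at this
        linarith
      calc _ ≤ (Real.log x + (n / x) ^ ε / ε) * (n : ℝ) ^ (-s) := by gcongr
        _ = _ := by
          rw [Real.div_rpow hnpos.le hx0.le, Real.rpow_neg hx0.le, show -(s - ε) = -s + ε by ring,
            Real.rpow_add hnpos]
          field_simp)
  rw [Finset.sum_add_distrib, ← Finset.mul_sum, ← Finset.mul_sum] at h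
  have hb' := hb x hx
  have hd' := hd x hx
  rw [powSum] at hb' hd'
  rw [abs_mul, abs_of_pos (Real.rpow_pos_of_pos hx0 _), pow_one]
  calc _ ≤ x ^ (s - 1) * (Real.log x * (C * x ^ (1 - s)) +
        x ^ (-ε) / ε * (D * x ^ (1 - (s - ε)))) := by
        gcongr
        refine h.trans ?_
        have i1 := mul_le_mul_of_nonneg_left hb' hl
        have i2 := mul_le_mul_of_nonneg_left hd' (by positivity : 0 ≤ x ^ (-ε) / ε)
        linarith
    _ = C * Real.log x * (x ^ (s - 1) * x ^ (1 - s)) +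
        D / ε * (x ^ (s - 1) * (x ^ (-ε) * x ^ (1 - (s - ε)))) := by ring
    _ = C * Real.log x + D / ε := by
        rw [← Real.rpow_add hx0, ← Real.rpow_add hx0, ← Real.rpow_add hx0]
        ring_nf
        simp
    _ ≤ _ := by
        have : 0 ≤ D / ε := by positivity
        nlinarith [mul_nonneg this hl]

lemma logBdd_dsum_vonMangoldt_idPow {a : ℝ} (ha : -1 < a) (ha' : a < 0) :
    LogBdd 1 (fun x => dsum (divId ArithmeticFunction.vonMangoldt)
      (dsum (idPow a) (fun _ => 1)) x -
        (-zetaR' (2 + a) / zetaR (2 + a)) / (1 + a) * x ^ (1 + a)) := by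
  refine logBdd_dsum_dsum_idPow ha ha' _ _ ?_ ?_
  · refine ⟨2, two_pos.le, fun x hx => ?_⟩
    rw [abs_of_nonneg (Finset.sum_nonneg fun _ _ => abs_nonneg _), pow_one]
    have h := sum_vonMangoldt_div_le hx
    have e : ∑ n ∈ Finset.Icc 1 ⌊x⌋₊, |divId ArithmeticFunction.vonMangoldt n| =
        ∑ n ∈ Finset.Icc 1 ⌊x⌋₊, ArithmeticFunction.vonMangoldt n / n :=
      Finset.sum_congr rfl fun n _ => by
        rw [divId_apply, abs_of_nonneg
          (div_nonneg ArithmeticFunction.vonMangoldt_nonneg (Nat.cast_nonneg n))]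
    change ∑ n ∈ Finset.Icc 1 ⌊x⌋₊, |divId ArithmeticFunction.vonMangoldt n| ≤ _
    rw [e]
    linarith
  · refine (logBdd_vonMangoldt_tail (s := 2 + a) (by linarith)).congr fun x _ => ?_
    rw [show 2 + a - 1 = 1 + a by ring]
    congr 2
    refine Finset.sum_congr rfl fun n hn => ?_
    have hn0 := (one_le_div_of_mem_Icc_floor hn).1
    rw [divId_apply, show -(2 + a) = -(1 + a) - 1 by ring, Real.rpow_sub_one hn0.ne']
    ring

/-! ### The remainder in Stirling's formula -/

lemma stirlingRem_eq {l : ℕ} (hl : 1 ≤ l) :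
    stirlingRem l = Real.log (Stirling.stirlingSeq l) - Real.log (√Real.pi) := by
  have hl0 : (0 : ℝ) < l := by exact_mod_cast hl
  rw [Stirling.log_stirlingSeq_formula, stirlingRem, Real.log_mul two_ne_zero hl0.ne',
    Real.log_div hl0.ne' (Real.exp_ne_zero 1), Real.log_exp, Real.log_sqrt (by positivity),
    Real.log_sqrt (by positivity), Real.log_mul two_ne_zero Real.pi_ne_zero]
  ring

/-- The Stirling sequence lies above its limit `√π`, and its next step down is strict since the
series for the logarithmic difference has a positive first term. -/
lemma stirlingRem_pos {l : ℕ} (hl : 1 ≤ l) : 0 < stirlingRem l := by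
  obtain ⟨m, rfl⟩ : ∃ m, l = m + 1 := ⟨l - 1, by lia⟩
  rw [stirlingRem_eq hl]
  have h1 := le_hasSum (Stirling.log_stirlingSeq_sdiff_hasSum m) 0 fun k _ => by positivity
  have h2 : (0 : ℝ) < 1 / (2 * ((0 + 1 : ℕ) : ℝ) + 1) *
      ((1 / (2 * ((m + 1 : ℕ) : ℝ) + 1)) ^ 2) ^ (0 + 1) := by positivity
  have h3 : Real.log (√Real.pi) ≤ Real.log (Stirling.stirlingSeq (m + 2)) :=
    Real.log_le_log (by positivity) (Stirling.sqrt_pi_le_stirlingSeq (by lia))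
  linarith

/-- Each step of `log stirlingSeq` falls by at most `1/(12 n(n+1))`, which telescopes; hence `log
(stirlingSeq n) - 1/(12 n)` increases to `log √π`. -/
lemma stirlingRem_le {l : ℕ} (hl : 1 ≤ l) : stirlingRem l ≤ 1 / (12 * l) := by
  have hl0 : (0 : ℝ) < l := by exact_mod_cast hl
  rw [stirlingRem_eq hl]
  have hmono : ∀ j : ℕ, Real.log (Stirling.stirlingSeq l) - 1 / (12 * l) ≤
      Real.log (Stirling.stirlingSeq (l + j)) - 1 / (12 * ((l + j : ℕ) : ℝ)) := by
    intro j
    induction j with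
    | zero => simp
    | succ j ih =>
      refine ih.trans ?_
      have h := Stirling.log_stirlingSeq_sdiff_le (l + j)
      have hp : (0 : ℝ) < ((l + j : ℕ) : ℝ) := by exact_mod_cast (by lia : 0 < l + j)
      have e : 1 / (12 * ((l + j : ℕ) : ℝ) * (((l + j : ℕ) : ℝ) + 1)) =
          1 / (12 * ((l + j : ℕ) : ℝ)) - 1 / (12 * ((l + (j + 1) : ℕ) : ℝ)) := by
        have : ((l + (j + 1) : ℕ) : ℝ) = ((l + j : ℕ) : ℝ) + 1 := by push_cast; ring
        rw [this]
        field_simp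
        ring
      rw [e] at h
      rw [← add_assoc] at h ⊢
      linarith
  have hlim : Tendsto (fun j : ℕ => Real.log (Stirling.stirlingSeq (l + j)) -
      1 / (12 * ((l + j : ℕ) : ℝ))) atTop (𝓝 (Real.log (√Real.pi) - 0)) := by
    have hadd : Tendsto (fun j : ℕ => l + j) atTop atTop :=
      tendsto_atTop_mono (fun j => Nat.le_add_left j l) tendsto_id
    refine Tendsto.sub ?_ ?_
    · exact ((Real.continuousAt_log (by positivity)).tendsto.comp
        Stirling.tendsto_stirlingSeq_sqrt_pi).comp hadd
    · have h0 : Tendsto (fun n : ℕ => 1 / (12 * (n : ℝ))) atTop (𝓝 0) := by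
        have := (tendsto_one_div_atTop_nhds_zero_nat (𝕜 := ℝ)).const_mul (1 / 12)
        rw [mul_zero] at this
        refine this.congr fun n => ?_
        field_simp
      exact h0.comp hadd
  have := ge_of_tendsto' hlim hmono
  linarith

/-- Here `r(1) = 1 - log √(2π)`, so the claim is `e^11 < (2π)^6`. This one strict term makes `Θ <
1/12` strict. -/
lemma stirlingRem_one_lt : stirlingRem 1 < 1 / 12 := by
  have h : 11 / 6 < Real.log (2 * Real.pi) := by
    rw [Real.lt_log_iff_exp_lt (by positivity)]
    refine lt_of_pow_lt_pow_left₀ 6 (by positivity) ?_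
    have e : Real.exp (11 / 6) ^ 6 = Real.exp 1 ^ 11 := by
      rw [← Real.exp_nat_mul, ← Real.exp_nat_mul]; norm_num
    rw [e]
    calc Real.exp 1 ^ 11 < 2.7182818286 ^ 11 := by
          gcongr; exact Real.exp_one_lt_d9
      _ < (2 * 3.14) ^ 6 := by norm_num
      _ < (2 * Real.pi) ^ 6 := by gcongr; exact Real.pi_gt_d2
  rw [stirlingRem, Real.log_sqrt (by positivity)]
  simp
  linarith

lemma exists_theta {a : ℝ} (ha : -1 < a) : ∃ Θ : ℝ, 0 < Θ ∧ Θ < 1 / 12 ∧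
    HasSum (fun l : ℕ => stirlingRem (l + 1) / ((l + 1 : ℕ) : ℝ) ^ (2 + a)) (Θ * zetaR (3 + a)) := by
  have hζ := zetaR_pos (s := 3 + a) (by linarith)
  have hb : HasSum (fun l : ℕ => 1 / 12 * ((l + 1 : ℕ) : ℝ) ^ (-(3 + a)))
      (1 / 12 * zetaR (3 + a)) := by
    refine HasSum.mul_left _ ?_
    have := (hasSum_nat_add_iff' 1).mpr (hasSum_zetaR (s := 3 + a) (by linarith))
    simpa [Real.zero_rpow (by linarith : -(3 + a) ≠ 0), -neg_add_rev] using this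
  have hle : ∀ l : ℕ, stirlingRem (l + 1) / ((l + 1 : ℕ) : ℝ) ^ (2 + a) ≤
      1 / 12 * ((l + 1 : ℕ) : ℝ) ^ (-(3 + a)) := by
    intro l
    have hp : (0 : ℝ) < ((l + 1 : ℕ) : ℝ) := by positivity
    calc _ ≤ 1 / (12 * ((l + 1 : ℕ) : ℝ)) / ((l + 1 : ℕ) : ℝ) ^ (2 + a) := by
          gcongr; exact stirlingRem_le (by lia)
      _ = _ := by
          rw [Real.rpow_neg hp.le, show 3 + a = 1 + (2 + a) by ring,
            Real.rpow_add hp 1 (2 + a), Real.rpow_one]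
          field_simp
  have hpos : ∀ l : ℕ, 0 < stirlingRem (l + 1) / ((l + 1 : ℕ) : ℝ) ^ (2 + a) := fun l =>
    div_pos (stirlingRem_pos (by lia)) (by positivity)
  have hsum : Summable (fun l : ℕ => stirlingRem (l + 1) / ((l + 1 : ℕ) : ℝ) ^ (2 + a)) :=
    Summable.of_nonneg_of_le (fun l => (hpos l).le) hle hb.summable
  refine ⟨(∑' l : ℕ, stirlingRem (l + 1) / ((l + 1 : ℕ) : ℝ) ^ (2 + a)) / zetaR (3 + a),
    div_pos (hsum.tsum_pos (fun l => (hpos l).le) 0 (hpos 0)) hζ, ?_, ?_⟩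
  · rw [div_lt_iff₀ hζ]
    refine hasSum_lt hle (i := 0) ?_ hsum.hasSum hb
    simpa using stirlingRem_one_lt
  · rw [div_mul_cancel₀ _ hζ.ne']
    exact hsum.hasSum

/-- The arithmetical function `l ↦ r(l) / l` built from the Stirling remainder. -/
def stirlingArith : ArithmeticFunction ℝ := ⟨fun l => stirlingRem l / l, by simp⟩

lemma stirlingArith_apply (l : ℕ) : stirlingArith l = stirlingRem l / l := rfl

lemma abs_stirlingArith_le (l : ℕ) : |stirlingArith l| ≤ (l : ℝ) ^ (-(2 : ℝ)) := by
  rcases eq_or_ne l 0 with rfl | hl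
  · simp
  have hl1 : 1 ≤ l := Nat.one_le_iff_ne_zero.mpr hl
  have hl0 : (0 : ℝ) < l := by exact_mod_cast hl1
  rw [stirlingArith_apply, abs_of_pos (div_pos (stirlingRem_pos hl1) hl0), Real.rpow_neg hl0.le]
  calc stirlingRem l / l ≤ 1 / (12 * l) / l := by gcongr; exact stirlingRem_le hl1
    _ ≤ 1 / l / l := by gcongr; linarith
    _ = _ := by rw [Real.rpow_two]; field_simp

lemma logBdd_dsum_stirlingArith_idPow {a : ℝ} (ha : -1 < a) (ha' : a < 0) {Z : ℝ}
    (hZ : HasSum (fun l : ℕ => stirlingRem (l + 1) / ((l + 1 : ℕ) : ℝ) ^ (2 + a)) Z) :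
    LogBdd 0 (fun x => dsum stirlingArith (dsum (idPow a) (fun _ => 1)) x -
      Z / (1 + a) * x ^ (1 + a)) := by
  have hZ' : HasSum (fun n : ℕ => stirlingArith n * (n : ℝ) ^ (-(1 + a))) Z := by
    have h0 : (fun l : ℕ => stirlingRem (l + 1) / ((l + 1 : ℕ) : ℝ) ^ (2 + a)) =
        fun l : ℕ => stirlingArith (l + 1) * ((l + 1 : ℕ) : ℝ) ^ (-(1 + a)) := by
      ext l
      have hp : (0 : ℝ) < ((l + 1 : ℕ) : ℝ) := by positivity
      rw [stirlingArith_apply, Real.rpow_neg hp.le, show 2 + a = 1 + (1 + a) by ring,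
        Real.rpow_add hp, Real.rpow_one]
      field_simp
    rw [h0] at hZ
    have := (hasSum_nat_add_iff (f := fun n : ℕ => stirlingArith n * (n : ℝ) ^ (-(1 + a))) 1).mp hZ
    simpa using this
  refine logBdd_dsum_dsum_idPow ha ha' _ _ ?_ ?_
  · obtain ⟨K, _, hK⟩ := powSum_le_of_one_lt one_lt_two
    refine LogBdd.of_bound (C := K) fun x _ => ?_
    rw [abs_of_nonneg (Finset.sum_nonneg fun _ _ => abs_nonneg _)]
    exact (Finset.sum_le_sum fun l _ => abs_stirlingArith_le l).trans (hK x)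
  · obtain ⟨C, hC, hb⟩ := zetaR_sub_powSum_le (s := 2 + a) (by linarith)
    refine LogBdd.of_bound (C := C) fun x hx => ?_
    have hx0 : 0 < x := one_pos.trans_le hx
    have h := abs_sub_sum_le_of_hasSum hZ' (hasSum_zetaR (s := 2 + a) (by linarith))
      (Finset.Icc 1 ⌊x⌋₊) (fun n _ => by
        rcases eq_or_ne n 0 with rfl | hn
        · simp; positivity
        have hn1 : (1 : ℝ) ≤ n := by exact_mod_cast Nat.one_le_iff_ne_zero.mpr hn
        have hn0 : (0 : ℝ) < n := by linarith
        rw [abs_mul, abs_of_nonneg (by positivity : (0 : ℝ) ≤ (n : ℝ) ^ (-(1 + a)))]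
        calc _ ≤ (n : ℝ) ^ (-(2 : ℝ)) * (n : ℝ) ^ (-(1 + a)) := by
              gcongr; exact abs_stirlingArith_le n
          _ = (n : ℝ) ^ (-(2 : ℝ) + -(1 + a)) := by rw [Real.rpow_add hn0]
          _ ≤ _ := Real.rpow_le_rpow_of_exponent_le hn1 (by linarith))
    have hb' := hb x hx
    rw [powSum] at hb'
    rw [abs_mul, abs_of_pos (Real.rpow_pos_of_pos hx0 _)]
    calc _ ≤ x ^ (1 + a) * (C * x ^ (1 - (2 + a))) := by
          gcongr
          exact h.trans hb'
      _ = C * (x ^ (1 + a) * x ^ (1 - (2 + a))) := by ring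
      _ = C := by rw [← Real.rpow_add hx0]; ring_nf; simp

/-! ### Decomposition of the gcd sum -/

lemma const_smul_apply (r : ℝ) (c : ArithmeticFunction ℝ) (n : ℕ) : (r • c) n = r * c n := rfl

/-- The part of `log(l!) / l` below `log l - 1` in Stirling's formula. -/
def stirlingTail : ArithmeticFunction ℝ :=
  (1 / 2 : ℝ) • divId ArithmeticFunction.log +
    Real.log (√(2 * Real.pi)) • divId (ArithmeticFunction.zeta : ArithmeticFunction ℝ) +
    stirlingArith

lemma log_factorial_div {l : ℕ} (hl : l ≠ 0) :
    Real.log (Nat.factorial l) / l = Real.log l - 1 + stirlingTail l := by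
  have hl0 : (l : ℝ) ≠ 0 := by exact_mod_cast hl
  simp only [stirlingTail, ArithmeticFunction.add_apply, const_smul_apply, divId_apply,
    stirlingArith_apply, ArithmeticFunction.log_apply, stirlingRem,
    ArithmeticFunction.natCoe_apply, ArithmeticFunction.zeta_apply, hl, if_false]
  push_cast
  field_simp
  ring

lemma sum_log_dvd {k d : ℕ} (hd : d ∣ k) (hk : k ≠ 0) :
    (∑ j ∈ Finset.Icc 1 k, if d ∣ j then Real.log j else 0) =
      ((k / d : ℕ) : ℝ) * Real.log d + Real.log (Nat.factorial (k / d)) := by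
  obtain ⟨l, rfl⟩ := hd
  have hd0 : d ≠ 0 := left_ne_zero_of_mul hk
  have hdpos : 0 < d := Nat.pos_of_ne_zero hd0
  rw [Nat.mul_div_cancel_left l hdpos, ← Finset.sum_filter]
  have e : (Finset.Icc 1 (d * l)).filter (fun j => d ∣ j) =
      (Finset.Icc 1 l).image (fun m => d * m) := by
    ext j
    simp only [Finset.mem_filter, Finset.mem_Icc, Finset.mem_image]
    constructor
    · rintro ⟨⟨h1, h2⟩, m, rfl⟩
      exact ⟨m, ⟨Nat.pos_of_ne_zero (by rintro rfl; simp at h1),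
        Nat.le_of_mul_le_mul_left h2 hdpos⟩, rfl⟩
    · rintro ⟨m, ⟨h1, h2⟩, rfl⟩
      exact ⟨⟨Nat.mul_pos hdpos h1, Nat.mul_le_mul_left d h2⟩, dvd_mul_right d m⟩
  rw [e, Finset.sum_image (fun m _ m' _ h => Nat.eq_of_mul_eq_mul_left hdpos h)]
  have e2 : ∀ m ∈ Finset.Icc 1 l, Real.log ((d * m : ℕ) : ℝ) = Real.log d + Real.log m := by
    intro m hm
    have hm0 : (m : ℝ) ≠ 0 := by
      have := (Finset.mem_Icc.mp hm).1
      exact_mod_cast (by lia : m ≠ 0)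
    rw [Nat.cast_mul, Real.log_mul (by exact_mod_cast hd0) hm0]
  rw [Finset.sum_congr rfl e2, Finset.sum_add_distrib, Finset.sum_const, Nat.card_Icc,
    add_tsub_cancel_right, nsmul_eq_mul, ← Finset.prod_Ico_id_eq_factorial, Nat.cast_prod,
    Finset.Ico_add_one_right_eq_Icc, Real.log_prod]
  intro m hm
  have := (Finset.mem_Icc.mp hm).1
  exact_mod_cast (by lia : m ≠ 0)

/-- Expand `f(gcd(k, j))` over the common divisors `d`. The multiples of `d` up to `k = dl`
contribute `l log d + log l!`, and Stirling's formula merges `log d + log l` into `log k`. -/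
lemma inv_mul_sum_gcd_log {f g : ArithmeticFunction ℝ}
    (hfg : g * (ArithmeticFunction.zeta : ArithmeticFunction ℝ) = f) {k : ℕ} (hk : k ≠ 0) :
    1 / (k : ℝ) * ∑ j ∈ Finset.Icc 1 k, f (Nat.gcd k j) * Real.log j =
      (divId g * (ArithmeticFunction.zeta : ArithmeticFunction ℝ)) k * (Real.log k - 1) +
        (divId g * stirlingTail) k := by
  have h1 : ∀ j, f (Nat.gcd k j) * Real.log j =
      ∑ d ∈ k.divisors, g d * if d ∣ j then Real.log j else 0 := by
    intro j
    have hg0 : Nat.gcd k j ≠ 0 := fun h => hk (Nat.eq_zero_of_gcd_eq_zero_left h)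
    rw [← hfg, ArithmeticFunction.coe_mul_zeta_apply, Finset.sum_mul]
    have e : (Nat.gcd k j).divisors = k.divisors.filter (fun d => d ∣ j) := by
      ext d
      simp only [Nat.mem_divisors, Finset.mem_filter, Nat.dvd_gcd_iff]
      tauto
    rw [e, Finset.sum_filter]
    refine Finset.sum_congr rfl fun d _ => ?_
    split_ifs <;> simp
  simp only [h1]
  rw [Finset.sum_comm]
  have h2 : ∀ d ∈ k.divisors, ∑ j ∈ Finset.Icc 1 k, g d * (if d ∣ j then Real.log j else 0) =
      g d * (((k / d : ℕ) : ℝ) * Real.log d + Real.log (Nat.factorial (k / d))) := fun d hd => by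
    rw [← Finset.mul_sum, sum_log_dvd (Nat.mem_divisors.mp hd).1 hk]
  rw [Finset.sum_congr rfl h2, ArithmeticFunction.mul_apply, ArithmeticFunction.mul_apply,
    Finset.sum_mul, ← Finset.sum_add_distrib, Finset.mul_sum,
    ← Nat.sum_divisorsAntidiagonal (fun d e => 1 / (k : ℝ) * (g d *
      ((e : ℝ) * Real.log d + Real.log (Nat.factorial e))))]
  refine Finset.sum_congr rfl fun p hp => ?_
  obtain ⟨hp1, -⟩ := Nat.mem_divisorsAntidiagonal.mp hp
  have hd : p.1 ≠ 0 := fun h => hk (by rw [← hp1, h, zero_mul])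
  have he : p.2 ≠ 0 := fun h => hk (by rw [← hp1, h, mul_zero])
  have hd' : (p.1 : ℝ) ≠ 0 := by exact_mod_cast hd
  have he' : (p.2 : ℝ) ≠ 0 := by exact_mod_cast he
  have hlog : Real.log (Nat.factorial p.2) = p.2 * (Real.log p.2 - 1 + stirlingTail p.2) := by
    rw [← log_factorial_div he]; field_simp
  rw [hlog, ← hp1, Nat.cast_mul, Real.log_mul hd' he', divId_apply,
    ArithmeticFunction.natCoe_apply, ArithmeticFunction.zeta_apply_ne he, Nat.cast_one]
  field_simp
  ring

lemma logGcdSum_eq {f g : ArithmeticFunction ℝ}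
    (hfg : g * (ArithmeticFunction.zeta : ArithmeticFunction ℝ) = f) {x : ℝ} (hx : 1 ≤ x) :
    logGcdSum x f =
      (Real.log x - 1) *
        dsum (divId g * (ArithmeticFunction.zeta : ArithmeticFunction ℝ)) (fun _ => 1) x -
      dsum (divId g * (ArithmeticFunction.zeta : ArithmeticFunction ℝ)) Real.log x +
      dsum (divId g * stirlingTail) (fun _ => 1) x := by
  rw [logGcdSum, dsum_one_one, dsum_one_one, dsum, Finset.mul_sum, ← Finset.sum_sub_distrib,
    ← Finset.sum_add_distrib]
  refine Finset.sum_congr rfl fun k hk => ?_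
  have hk0 : k ≠ 0 := by have := (Finset.mem_Icc.mp hk).1; lia
  rw [inv_mul_sum_gcd_log hfg hk0, Real.log_div (by linarith) (by exact_mod_cast hk0)]
  ring

lemma divId_idPow (a : ℝ) : divId (idPow (1 + a)) = idPow a := by
  ext n
  rcases eq_or_ne n 0 with rfl | hn
  · simp
  · have hn0 : (0 : ℝ) < n := by exact_mod_cast Nat.pos_of_ne_zero hn
    rw [divId_apply, idPow_apply _ hn, idPow_apply _ hn, Real.rpow_add hn0, Real.rpow_one]
    field_simp

/-! ### The three constituents after one Möbius twist -/

/-- The `Δ_a` sum is kept exactly, so the error is `O(1)`; it must be, since this expansion is later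
multiplied by `log x - 1`. -/
lemma logBdd_dsum_sigmaR_one {a : ℝ} (ha : -1 < a) :
    LogBdd 0 (fun x => dsum (divId moebiusR) (dsum (sigmaR a) (fun _ => 1)) x -
      (zetaR (1 - a) / zetaR 2 * x + zetaR (1 + a) / (1 + a) / zetaR (2 + a) * x ^ (1 + a) +
        dsum (divId moebiusR) (Delta a) x)) := by
  have h := ((logBdd_dsum_moebius_id.const_mul (zetaR (1 - a))).add
    ((logBdd_dsum_moebius_rpow (s := 1 + a) (by linarith)).const_mul
      (zetaR (1 + a) / (1 + a)))).sub
    (logBdd_dsum_moebius_one.const_mul (zetaR (-a) / 2))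
  refine h.congr fun x _ => ?_
  have e : dsum (divId moebiusR) (dsum (sigmaR a) (fun _ => 1)) x =
      dsum (divId moebiusR) (fun y => zetaR (1 - a) * y + zetaR (1 + a) / (1 + a) * y ^ (1 + a) -
        zetaR (-a) / 2 * 1 + Delta a y) x :=
    dsum_congr _ fun y _ => by rw [dsum_one_one, Delta]; ring
  rw [e, dsum_add, dsum_sub, dsum_add, dsum_const_mul, dsum_const_mul, dsum_const_mul,
    show 1 + (1 + a) = 2 + a by ring]
  ring

lemma logBdd_dsum_sigmaR_log {a : ℝ} (ha : -1 < a) (ha' : a < 0) :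
    LogBdd 1 (fun x => dsum (divId moebiusR) (dsum (sigmaR a) Real.log) x -
      (zetaR (1 - a) / zetaR 2 * x +
        zetaR (1 + a) / (1 + a) ^ 2 / zetaR (2 + a) * x ^ (1 + a))) := by
  obtain ⟨C, hC⟩ := abs_dsum_sigmaR_log_sub_le ha ha'
  have h0 : LogBdd 0 (fun y => dsum (sigmaR a) Real.log y - (zetaR (1 - a) * y +
      zetaR (1 + a) / (1 + a) ^ 2 * y ^ (1 + a) + -(zetaR (-a) / 2) * Real.log y)) :=
    (LogBdd.of_bound hC).congr fun y _ => by ring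
  have h1 := h0.dsum_moebius_expansion (by linarith)
  refine (h1.add (logBdd_dsum_moebius_log.const_mul (-(zetaR (-a) / 2)))).congr fun x _ => ?_
  rw [dsum_const_mul, show 1 + (1 + a) = 2 + a by ring]
  ring

lemma divId_moebiusR_mul_divId_log :
    divId moebiusR * divId ArithmeticFunction.log = divId ArithmeticFunction.vonMangoldt := by
  rw [← divId_mul, moebiusR, ArithmeticFunction.moebius_mul_log_eq_vonMangoldt]

lemma divId_moebiusR_mul_divId_zeta :
    divId moebiusR * divId (ArithmeticFunction.zeta : ArithmeticFunction ℝ) = 1 := by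
  rw [← divId_mul, moebiusR_mul_zeta, divId_one]

/-- Convolving with `μ/id` turns the three parts of `stirlingTail` into `Λ/id`, the unit, and `μ/id
* stirlingArith`. Only the last still carries a Möbius twist, hence the `1/ζ(2+a)` on `Z`. -/
lemma logBdd_dsum_stirlingTail {a : ℝ} (ha : -1 < a) (ha' : a < 0) {Z : ℝ}
    (hZ : HasSum (fun l : ℕ => stirlingRem (l + 1) / ((l + 1 : ℕ) : ℝ) ^ (2 + a)) Z) :
    LogBdd 1 (fun x => dsum (divId moebiusR * idPow a * stirlingTail) (fun _ => 1) x -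
      (1 / 2 * ((-zetaR' (2 + a) / zetaR (2 + a)) / (1 + a)) +
        Real.log (√(2 * Real.pi)) / (1 + a) + Z / (1 + a) / zetaR (2 + a)) * x ^ (1 + a)) := by
  have h1 := (logBdd_dsum_vonMangoldt_idPow ha ha').const_mul (1 / 2)
  have h2 := ((logBdd_powSum_sub ha ha').const_mul (Real.log (√(2 * Real.pi)))).mono zero_le_one
  have h3 : LogBdd 0 (fun y => dsum stirlingArith (dsum (idPow a) (fun _ => 1)) y -
      (0 * y + Z / (1 + a) * y ^ (1 + a) + 0 * (fun _ => 1) y)) :=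
    (logBdd_dsum_stirlingArith_idPow ha ha' hZ).congr fun y _ => by ring
  have h4 := h3.dsum_moebius_expansion (by linarith)
  refine ((h1.add h2).add h4).congr fun x hx => ?_
  have e : divId moebiusR * idPow a * stirlingTail =
      (1 / 2 : ℝ) • (divId ArithmeticFunction.vonMangoldt * idPow a) +
      Real.log (√(2 * Real.pi)) • idPow a + divId moebiusR * (stirlingArith * idPow a) := by
    rw [mul_assoc, mul_comm (idPow a), ← mul_assoc, stirlingTail, mul_add, mul_add, mul_smul_comm,
      mul_smul_comm, divId_moebiusR_mul_divId_log, divId_moebiusR_mul_divId_zeta, add_mul, add_mul,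
      smul_mul_assoc, smul_mul_assoc, one_mul, mul_assoc]
  have hadd : ∀ (r : ℝ) (c d e : ArithmeticFunction ℝ) (W : ℝ → ℝ),
      dsum ((1 / 2 : ℝ) • c + r • d + e) W x = 1 / 2 * dsum c W x + r * dsum d W x + dsum e W x := by
    intro r c d e W
    simp only [dsum, Finset.mul_sum, ← Finset.sum_add_distrib, ArithmeticFunction.add_apply,
      const_smul_apply]
    exact Finset.sum_congr rfl fun _ _ => by ring
  rw [e, hadd, dsum_mul, dsum_mul (divId moebiusR), dsum_const_mul,
    dsum_congr (divId moebiusR) (fun y _ => dsum_mul stirlingArith (idPow a) (fun _ => 1) y),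
    show 1 + (1 + a) = 2 + a by ring]
  ring

end LogGcdSum

end

/-! ### Assembly of the two asymptotic expansions. -/

open LogGcdSum in
theorem theorem5 (a : ℝ) (ha : -1 < a) (ha' : a < 0) :
    ∃ Θ : ℝ, 0 < Θ ∧ Θ < 1 / 12 ∧
      HasSum (fun l : ℕ => stirlingRem (l + 1) / ((l + 1 : ℕ) : ℝ) ^ (2 + a))
        (Θ * zetaR (3 + a)) ∧
      ((fun x : ℝ => logGcdSum x (idPow (1 + a)) -
          (zetaR (1 - a) / zetaR 2 * x * Real.log x
            - 2 * zetaR (1 - a) / zetaR 2 * x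
            + zetaR (1 + a) / ((1 + a) * zetaR (2 + a)) * x ^ (1 + a) * Real.log x
            - 1 / ((1 + a) * zetaR (2 + a)) *
                ((2 + a) * zetaR (1 + a) / (1 + a) + zetaR' (2 + a) / 2
                  - Θ * zetaR (3 + a)) * x ^ (1 + a)
            + Real.log (Real.sqrt (2 * Real.pi)) / (1 + a) * x ^ (1 + a)
            + deltaSum moebiusR a x * Real.log (x / Real.exp 1)))
        =O[atTop] fun x : ℝ => Real.log x) ∧
      ((fun x : ℝ => logGcdSum x (jordan (1 + a)) -
          (zetaR (1 - a) / zetaR 2 ^ 2 * x * Real.log x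
            - 2 * zetaR (1 - a) / zetaR 2 ^ 2 * x
            + zetaR (1 + a) / ((1 + a) * zetaR (2 + a) ^ 2) * x ^ (1 + a) * Real.log x
            - 1 / ((1 + a) * zetaR (2 + a) ^ 2) *
                ((2 + a) * zetaR (1 + a) / (1 + a) + zetaR' (2 + a) / 2
                  - Θ * zetaR (3 + a)) * x ^ (1 + a)
            + Real.log (Real.sqrt (2 * Real.pi)) / ((1 + a) * zetaR (2 + a)) * x ^ (1 + a)
            + deltaSum (moebiusR * moebiusR) a x * Real.log (x / Real.exp 1)))
        =O[atTop] fun x : ℝ => Real.log x ^ 3) := by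
  obtain ⟨Θ, hΘ0, hΘ1, hΘ⟩ := exists_theta ha
  refine ⟨Θ, hΘ0, hΘ1, hΘ, ?_, ?_⟩
  all_goals
    have hA := logBdd_dsum_sigmaR_one ha
    have hB := logBdd_dsum_sigmaR_log ha ha'
    have hT := logBdd_dsum_stirlingTail ha ha' hΘ
    have h1a : 1 + a ≠ 0 := by linarith
    have hz2 : zetaR 2 ≠ 0 := (zetaR_pos one_lt_two).ne'
    have hz2a : zetaR (2 + a) ≠ 0 := (zetaR_pos (by linarith)).ne'
    have hσ : ∀ c : ArithmeticFunction ℝ,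
        c * idPow a * (ArithmeticFunction.zeta : ArithmeticFunction ℝ) = c * sigmaR a := fun c => by
      rw [sigmaR, mul_assoc, mul_comm (idPow a)]
    have hlog : ∀ x : ℝ, 1 ≤ x → Real.log (x / Real.exp 1) = Real.log x - 1 := fun x hx => by
      rw [Real.log_div (by linarith) (Real.exp_ne_zero 1), Real.log_exp]
  -- Each constituent has error `O(log x)`. The coefficient `2` of `x` and the `(2+a)/(1+a)` collect
  -- the `-1` in `log x - 1` and the subtracted `hB`.
  · have key := ((hA.log_sub_one_mul.sub hB).add hT).isBigO
    simp only [zero_add, pow_one] at key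
    refine key.congr' ?_ EventuallyEq.rfl
    filter_upwards [eventually_ge_atTop 1] with x hx
    have hfg : moebiusR * idPow (1 + a) * (ArithmeticFunction.zeta : ArithmeticFunction ℝ) =
        idPow (1 + a) := by
      rw [mul_comm moebiusR, mul_assoc, moebiusR_mul_zeta, mul_one]
    have hd : deltaSum moebiusR a x = dsum (divId moebiusR) (Delta a) x := rfl
    rw [logGcdSum_eq hfg hx, divId_mul, divId_idPow, hσ, dsum_mul _ (sigmaR a),
      dsum_mul _ (sigmaR a), hlog x hx, hd]
    field_simp
    ring
  · have hA2 := (hA.dsum_moebius_expansion (by linarith)).log_sub_one_mul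
    have hB2 := LogBdd.dsum_moebius_expansion (s := 1 + a) (D := fun _ => 0) (by linarith)
      (hB.congr fun x _ => by rw [add_zero])
    have hT2 := LogBdd.dsum_moebius_expansion (s := 1 + a) (α := 0) (D := fun _ => 0) (by linarith)
      (hT.congr fun x _ => by rw [add_zero, zero_mul, zero_add])
    -- The second twist raises every error to `O((log x)^2)`, better than the exponent `3` required.
    have key := (((hA2.sub hB2).add hT2).mono (by norm_num : 2 ≤ 3)).isBigO
    refine key.congr' ?_ EventuallyEq.rfl
    filter_upwards [eventually_ge_atTop 1] with x hx
    have hfg : moebiusR * (moebiusR * idPow (1 + a)) *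
        (ArithmeticFunction.zeta : ArithmeticFunction ℝ) = jordan (1 + a) := by
      rw [jordan, mul_comm moebiusR (moebiusR * idPow (1 + a)), mul_assoc, moebiusR_mul_zeta,
        mul_one]
    have hd : deltaSum (moebiusR * moebiusR) a x =
        dsum (divId moebiusR) (dsum (divId moebiusR) (Delta a)) x := by
      rw [← dsum_mul, ← divId_mul]
      rfl
    have h0 : dsum (divId moebiusR) (fun _ => 0) x = 0 := by simp [dsum]
    have hS : ∀ W, dsum (divId (moebiusR * (moebiusR * idPow (1 + a))) *
        (ArithmeticFunction.zeta : ArithmeticFunction ℝ)) W x =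
        dsum (divId moebiusR) (dsum (divId moebiusR) (dsum (sigmaR a) W)) x := fun W => by
      rw [← dsum_mul, ← dsum_mul, divId_mul, divId_mul, divId_idPow, ← mul_assoc, hσ]
    have hV : dsum (divId (moebiusR * (moebiusR * idPow (1 + a))) * stirlingTail) (fun _ => 1) x =
        dsum (divId moebiusR) (dsum (divId moebiusR * idPow a * stirlingTail) (fun _ => 1)) x := by
      rw [← dsum_mul, divId_mul, divId_mul, divId_idPow, ← mul_assoc, ← mul_assoc]
      simp only [mul_assoc]
    rw [logGcdSum_eq hfg hx, hS, hS, hV, hlog x hx, hd, h0, show 1 + (1 + a) = 2 + a by ring]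
    field_simp
    ring
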